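/- Gaussian processes are indexed by $[0,\infty)$, real valued, and separable (there are a countable set $D\subset[0,\infty)$ and a null event off which, for all open $I\subset[0,\infty)$ and closed $F\subset\mathbb R$, a path lying in $F$ on $I\cap D$ lies in $F$ on all of $I$; e.g. processes with continuous paths). Suprema take values in $(-\infty,+\infty]$, and $\log 0=-\infty$. Let $\mathcal S_+$ be the set of non-negative stationary auto-correlation functions, i.e. of $A:[0,\infty)\to[0,1]$ with $A(0)=1$ for which $(s,t)\mapsto A(|s-t|)$ is positive semidefinite. (1) For every $A\in\mathcal S_+$ and every centered stationary Gaussian process $\{Z_t\}_{t\ge0}$ with auto-correlation $A$ (that is, with constant variance in $(0,\infty)$ and correlation of $Z_s,Z_t$ equal to $A(|t-s|)$), the non-negative, possibly infinite, limit $$b(A):=-\lim_{T\to\infty}\frac1T\log\mathbb P\Big(\sup_{t\in[0,T]}Z_t<0\Big)$$ exists, and it depends on $A$ only. (2) Let $\{Z^{(k)}_t\}_{t\ge0}$, $1\le k\le\infty$, be centered Gaussian processes with $\mathbb E[(Z^{(k)}_t)^2]=1$ for all $t$ and with non-negative auto-correlations $A_k(s,t)=\mathbb E[Z^{(k)}_sZ^{(k)}_t]$,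 such that $Z^{(\infty)}$ is stationary with auto-correlation $A_\infty\in\mathcal S_+$. Suppose that (i) $\displaystyle\limsup_{k,\tau\to\infty}\ \sup_{s\ge0}\frac{\log A_k(s,s+\tau)}{\log\tau}<-1$; (ii) $\displaystyle\limsup_{M\to\infty}\frac1M\log\mathbb P\Big(\sup_{t\in[0,M]}Z^{(\infty)}_t<M^{-\eta}\Big)=-b(A_\infty)$ for every $\eta>0$; (iii) there are $\zeta>0$ and $M_1<\infty$ such that for all $z\in[0,\zeta]$ and $M\ge M_1$, $$\mathbb P\Big(\sup_{t\in[0,M]}Z^{(\infty)}_t<z\Big)\le\liminf_{k\to\infty}\inf_{s\ge0}\mathbb P\Big(\sup_{t\in[0,M]}Z^{(k)}_{s+t}<z\Big)\le\limsup_{k\to\infty}\sup_{s\ge0}\mathbb P\Big(\sup_{t\in[0,M]}Z^{(k)}_{s+t}<z\Big)\le\mathbb P\Big(\sup_{t\in[0,M]}Z^{(\infty)}_t\le z\Big).$$ Then $$\lim_{k,T\to\infty}\frac1T\log\mathbb P\Big(\sup_{t\in[0,T]}Z^{(k)}_t<0\Big)=-b(A_\infty),$$ where $k,T\to\infty$ jointly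 (with no relation between $k$ and $T$). -/

import Mathlib

open Filter Topology MeasureTheory ProbabilityTheory
open scoped NNReal ENNReal

universe u

noncomputable section

namespace Persistence

/-- The class of stationary auto-correlation functions `A`, as functions of the time lag:
`A 0 = 1` and the kernel `(s, t) ↦ A |s - t|` is positive semidefinite.
(These conditions force `A` to take its values in `[-1, 1]`.) -/
def StationaryAutocorr : Set (ℝ≥0 → ℝ) :=
  {A | A 0 = 1 ∧ ∀ (n : ℕ) (t : Fin n → ℝ≥0) (c : Fin n → ℝ),
    0 ≤ ∑ i, ∑ j, c i * c j * A (nndist (t i) (t j))}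

/-- The non-negative stationary auto-correlation functions. -/
def StationaryAutocorrPlus : Set (ℝ≥0 → ℝ) :=
  {A | A ∈ StationaryAutocorr ∧ ∀ τ, 0 ≤ A τ}

variable {Ω : Type u} [MeasurableSpace Ω]

/-- Separability of a process: for some countable set `D` of times and outside a single null event,
for every open set `I` of times and every closed `F ⊆ ℝ`, the path stays in `F` on `I` as soon
as it stays in `F` on `I ∩ D`. (Taking `F = ∅` shows that `D` is dense.) -/
def IsSeparableProcess (Z : ℝ≥0 → Ω → ℝ) (μ : Measure Ω) : Prop :=
  ∃ D : Set ℝ≥0, D.Countable ∧ ∀ᵐ ω ∂μ, ∀ I : Set ℝ≥0, IsOpen I → ∀ F : Set ℝ, IsClosed F →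
    (∀ t ∈ I ∩ D, Z t ω ∈ F) → ∀ t ∈ I, Z t ω ∈ F

/-- A (separable) centered real Gaussian process indexed by `[0, ∞)`. -/
structure IsCenteredGaussian (Z : ℝ≥0 → Ω → ℝ) (μ : Measure Ω) : Prop where
  gaussian : IsGaussianProcess Z μ
  centered : ∀ t, ∫ ω, Z t ω ∂μ = 0
  separable : IsSeparableProcess Z μ

/-- The auto-correlation function of a process. -/
def autocorr (Z : ℝ≥0 → Ω → ℝ) (μ : Measure Ω) (s t : ℝ≥0) : ℝ :=
  cov[Z s, Z t; μ] / (√(Var[Z s; μ]) * √(Var[Z t; μ]))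

/-- `Z` is a centered stationary Gaussian process (constant, non-zero variance) whose
auto-correlation at times `s` and `s + τ` is `A τ`. -/
structure IsStationaryGaussian (Z : ℝ≥0 → Ω → ℝ) (μ : Measure Ω) (A : ℝ≥0 → ℝ) : Prop where
  centeredGaussian : IsCenteredGaussian Z μ
  variance_pos : 0 < Var[Z 0; μ]
  variance_const : ∀ t, Var[Z t; μ] = Var[Z 0; μ]
  autocorr_eq : ∀ s τ, autocorr Z μ s (s + τ) = A τ

/-- The supremum `sup_{t ∈ [0, M]} Z_{s + t}`, as an extended real random variable. -/
def windowSup (Z : ℝ≥0 → Ω → ℝ) (s M : ℝ≥0) (ω : Ω) : EReal :=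
  ⨆ t ∈ Set.Icc 0 M, ((Z (s + t) ω : ℝ) : EReal)

/-- `T⁻¹ * log p`, an extended real, with `log 0 = -∞`. -/
def logRate (T : ℝ≥0) (p : ℝ≥0∞) : EReal :=
  ENNReal.log p / ((T : ℝ) : EReal)

end Persistence

end

/-! Everything rests on Slepian's inequality: among centered Gaussian vectors with equal variances,
larger covariances make a lower orthant more likely (`slepian`). It is used through comparison
vectors built from independent copies of the process on finite blocks, mixed with a Gaussian vector
constant on each block (`blockProcess`).

Lower bound: non-negative correlations dominate independence between blocks, so persistence
probabilities are supermultiplicative up to translation (`pow_le_persistProb`). For a stationary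
process this is Fekete's argument: the limit exists and equals the supremum of the rates. Slepian
applied in both directions shows that it depends on the correlations only. For varying `k`, one
window length `M` whose limiting rate is nearly optimal suffices: by (iii) its probability is almost
attained for large `k`, uniformly in the starting point, and supermultiplicativity carries the bound
to all large `T`.

Upper bound: cut `[0, T]` into windows of length `M` separated by gaps `L = δM`. By (i),
correlations between windows `i` and `j` are at most `ε B i j`, with `ε` of order `L ^ (-α)` for
some `α > 1` and `B` a Toeplitz matrix with unit diagonal and row sums at most `2`. Slepian replaces
`Z` by `√(1 - ε)` times independent window copies plus `√ε ν`, `ν ~ N(0, B)`. In each window, either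
`ν ≤ -x`, which costs `exp (-x² / 4)`, or the copy stays below a small level `z`; hence the bound
`(exp (-x² / 4) + p) ^ n` (`measure_blocks_le`). With `x = M ^ ((1 + α) / 4)` the first term is
superexponentially small in `M`, while `z = M ^ (-(α - 1) / 8)` is admissible. Then (iii) passes to
the limit process, (ii) removes the level, and small `δ` makes the gaps negligible. -/

noncomputable section

namespace Persistence

/-! ### Smooth orthant functions and their Taylor expansion -/

section Slepian

variable {ι : Type*} [Fintype ι]

/-- A smooth, coordinatewise decreasing approximation of the indicator of a lower orthant. -/
def sigmoidProd (a x : ι → ℝ) : ℝ := ∏ i, Real.sigmoid (a i - x i)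

/-- As `σ' = σ (1 - σ)`, the derivative of `sigmoidProd` along `u` is `-sigmoidProd * sigmoidLin`;
`sigmoidQuad` and `-sigmoidCub` are the next derivatives of `sigmoidLin`. Every derivative of the
product is thus the product times a polynomial in these bounded sums. -/
def sigmoidLin (a x u : ι → ℝ) : ℝ := ∑ i, u i * (1 - Real.sigmoid (a i - x i))

def sigmoidQuad (a x u : ι → ℝ) : ℝ :=
  ∑ i, u i ^ 2 * (Real.sigmoid (a i - x i) * (1 - Real.sigmoid (a i - x i)))

def sigmoidCub (a x u : ι → ℝ) : ℝ :=
  ∑ i, u i ^ 3 * (Real.sigmoid (a i - x i) * (1 - Real.sigmoid (a i - x i)) *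
    (1 - 2 * Real.sigmoid (a i - x i)))

lemma sigmoidProd_nonneg (a x : ι → ℝ) : 0 ≤ sigmoidProd a x :=
  Finset.prod_nonneg fun _ _ => Real.sigmoid_nonneg _

lemma sigmoidProd_le_one (a x : ι → ℝ) : sigmoidProd a x ≤ 1 :=
  Finset.prod_le_one (fun _ _ => Real.sigmoid_nonneg _) fun _ _ => Real.sigmoid_le_one _

lemma continuous_sigmoidProd (a : ι → ℝ) : Continuous (sigmoidProd a) := by
  unfold sigmoidProd
  exact continuous_finsetProd _ fun i _ => _root_.continuous_sigmoid.comp (by fun_prop)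

lemma hasDerivAt_sigmoid_line (a w u s : ℝ) :
    HasDerivAt (fun s => Real.sigmoid (a - (w + s * u)))
      (-u * (Real.sigmoid (a - (w + s * u)) * (1 - Real.sigmoid (a - (w + s * u))))) s := by
  have h1 : HasDerivAt (fun s : ℝ => a - (w + s * u)) (-u) s := by
    simpa using (((hasDerivAt_id s).mul_const u).const_add w).const_sub a
  have h2 := HasDerivAt.comp s (Real.hasDerivAt_sigmoid (a - (w + s * u))) h1
  exact h2.congr_deriv (by ring)

lemma hasDerivAt_sigmoidProd (a w u : ι → ℝ) (s : ℝ) :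
    HasDerivAt (fun s : ℝ => sigmoidProd a (w + s • u))
      (-(sigmoidProd a (w + s • u) * sigmoidLin a (w + s • u) u)) s := by
  classical
  have h := HasDerivAt.fun_finsetProd (u := Finset.univ)
    (fun i _ => hasDerivAt_sigmoid_line (a i) (w i) (u i) s)
  refine HasDerivAt.congr_deriv h ?_
  simp only [sigmoidLin, Finset.mul_sum, ← Finset.sum_neg_distrib, sigmoidProd, Pi.add_apply,
    Pi.smul_apply, smul_eq_mul]
  refine Finset.sum_congr rfl fun i hi => ?_
  rw [← Finset.prod_erase_mul _ _ hi]
  ring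

lemma hasDerivAt_sigmoidLin (a w u : ι → ℝ) (s : ℝ) :
    HasDerivAt (fun s : ℝ => sigmoidLin a (w + s • u) u) (sigmoidQuad a (w + s • u) u) s := by
  unfold sigmoidLin sigmoidQuad
  refine HasDerivAt.fun_sum fun i _ => ?_
  refine HasDerivAt.congr_deriv
    (((hasDerivAt_sigmoid_line (a i) (w i) (u i) s).const_sub 1).const_mul (u i)) ?_
  simp only [Pi.add_apply, Pi.smul_apply, smul_eq_mul]
  ring

lemma hasDerivAt_sigmoidQuad (a w u : ι → ℝ) (s : ℝ) :
    HasDerivAt (fun s : ℝ => sigmoidQuad a (w + s • u) u) (-sigmoidCub a (w + s • u) u) s := by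
  unfold sigmoidQuad sigmoidCub
  rw [← Finset.sum_neg_distrib]
  refine HasDerivAt.fun_sum fun i _ => ?_
  have h := hasDerivAt_sigmoid_line (a i) (w i) (u i) s
  refine HasDerivAt.congr_deriv ((h.mul (h.const_sub 1)).const_mul (u i ^ 2)) ?_
  simp only [Pi.add_apply, Pi.smul_apply, smul_eq_mul]
  ring

lemma abs_sigmoidLin_le (a x u : ι → ℝ) : |sigmoidLin a x u| ≤ ∑ i, |u i| := by
  refine (Finset.abs_sum_le_sum_abs _ _).trans (Finset.sum_le_sum fun i _ => ?_)
  have h0 := Real.sigmoid_nonneg (a i - x i)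
  have h1 := Real.sigmoid_le_one (a i - x i)
  rw [abs_mul, abs_of_nonneg (sub_nonneg.2 h1)]
  exact mul_le_of_le_one_right (abs_nonneg _) (by linarith)

lemma sigmoidQuad_nonneg (a x u : ι → ℝ) : 0 ≤ sigmoidQuad a x u :=
  Finset.sum_nonneg fun _ _ => mul_nonneg (sq_nonneg _)
    (mul_nonneg (Real.sigmoid_nonneg _) (sub_nonneg.2 (Real.sigmoid_le_one _)))

lemma sum_pow_le_pow_sum_abs (u : ι → ℝ) (n : ℕ) :
    ∑ i, |u i| ^ (n + 1) ≤ (∑ i, |u i|) ^ (n + 1) := by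
  rw [pow_succ, Finset.mul_sum]
  refine Finset.sum_le_sum fun i hi => ?_
  rw [pow_succ]
  gcongr
  exact Finset.single_le_sum (f := fun i => |u i|) (fun _ _ => abs_nonneg _) hi

lemma sigmoidQuad_le (a x u : ι → ℝ) : sigmoidQuad a x u ≤ (∑ i, |u i|) ^ 2 := by
  refine le_trans (Finset.sum_le_sum fun i _ => ?_) (sum_pow_le_pow_sum_abs u 1)
  have h0 := Real.sigmoid_nonneg (a i - x i)
  have h1 := Real.sigmoid_le_one (a i - x i)
  rw [sq_abs]
  exact mul_le_of_le_one_right (sq_nonneg _) (mul_le_one₀ h1 (by linarith) (by linarith))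

lemma abs_sigmoidCub_le (a x u : ι → ℝ) : |sigmoidCub a x u| ≤ (∑ i, |u i|) ^ 3 := by
  refine (Finset.abs_sum_le_sum_abs _ _).trans
    (le_trans (Finset.sum_le_sum fun i _ => ?_) (sum_pow_le_pow_sum_abs u 2))
  have h0 := Real.sigmoid_nonneg (a i - x i)
  have h1 := Real.sigmoid_le_one (a i - x i)
  rw [abs_mul, abs_pow]
  refine mul_le_of_le_one_right (by positivity) ?_
  rw [abs_mul]
  refine mul_le_one₀ ?_ (abs_nonneg _) (abs_le.2 ⟨by linarith, by linarith⟩)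
  rw [abs_of_nonneg (mul_nonneg h0 (by linarith))]
  exact mul_le_one₀ h1 (by linarith) (by linarith)

/-- Second-order Taylor expansion on `[0, 1]` with a bound on the third derivative. -/
lemma abs_taylor_two_le {f f₁ f₂ f₃ : ℝ → ℝ} {K : ℝ} (h0 : ∀ s, HasDerivAt f (f₁ s) s)
    (h1 : ∀ s, HasDerivAt f₁ (f₂ s) s) (h2 : ∀ s, HasDerivAt f₂ (f₃ s) s)
    (hK : ∀ s, |f₃ s| ≤ K) : |f 1 - f 0 - f₁ 0 - f₂ 0 / 2| ≤ K := by
  have hK0 : 0 ≤ K := (abs_nonneg _).trans (hK 0)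
  have key : ∀ g g' : ℝ → ℝ, (∀ s, HasDerivAt g (g' s) s) → (∀ s ∈ Set.Icc (0 : ℝ) 1, |g' s| ≤ K) →
      ∀ s ∈ Set.Icc (0 : ℝ) 1, |g s - g 0| ≤ K := by
    intro g g' hg hg' s hs
    have := Convex.norm_image_sub_le_of_norm_hasDerivWithin_le (f := g) (f' := g') (C := K)
      (fun x _ => (hg x).hasDerivWithinAt) hg' (convex_Icc 0 1) (Set.left_mem_Icc.2 zero_le_one) hs
    refine this.trans ?_
    rw [Real.norm_eq_abs, sub_zero, abs_of_nonneg hs.1]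
    exact mul_le_of_le_one_right hK0 hs.2
  have k2 := key f₂ f₃ h2 fun s _ => hK s
  have k1 := key (fun s => f₁ s - s * f₂ 0) (fun s => f₂ s - f₂ 0)
    (fun s => HasDerivAt.congr_deriv ((h1 s).sub ((hasDerivAt_id s).mul_const (f₂ 0))) (by simp)) k2
  have k0 := key (fun s => f s - s * f₁ 0 - s ^ 2 * (f₂ 0 / 2)) (fun s => f₁ s - f₁ 0 - s * f₂ 0)
    (fun s => HasDerivAt.congr_deriv (((h0 s).sub ((hasDerivAt_id s).mul_const (f₁ 0))).sub
        ((hasDerivAt_pow 2 s).mul_const (f₂ 0 / 2))) (by simp; ring))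
    (fun s hs => by simpa [sub_right_comm] using k1 s hs)
  have := k0 1 (by simp)
  convert this using 2
  ring

lemma abs_sigmoidProd_taylor_le (a w u : ι → ℝ) :
    |sigmoidProd a (w + u) - sigmoidProd a w + sigmoidProd a w * sigmoidLin a w u -
      sigmoidProd a w * (sigmoidLin a w u ^ 2 - sigmoidQuad a w u) / 2|
        ≤ 5 * (∑ i, |u i|) ^ 3 := by
  have h0 := hasDerivAt_sigmoidProd a w u
  have hL := hasDerivAt_sigmoidLin a w u
  have hQ := hasDerivAt_sigmoidQuad a w u
  have h1 : ∀ s, HasDerivAt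
      (fun s : ℝ => -(sigmoidProd a (w + s • u) * sigmoidLin a (w + s • u) u))
      (sigmoidProd a (w + s • u) *
        (sigmoidLin a (w + s • u) u ^ 2 - sigmoidQuad a (w + s • u) u)) s := by
    intro s
    exact ((h0 s).mul (hL s)).neg.congr_deriv (by ring)
  have h2 : ∀ s, HasDerivAt
      (fun s : ℝ => sigmoidProd a (w + s • u) *
        (sigmoidLin a (w + s • u) u ^ 2 - sigmoidQuad a (w + s • u) u))
      (sigmoidProd a (w + s • u) * (-sigmoidLin a (w + s • u) u ^ 3 +
        3 * (sigmoidLin a (w + s • u) u * sigmoidQuad a (w + s • u) u) +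
        sigmoidCub a (w + s • u) u)) s := by
    intro s
    exact ((h0 s).mul (((hL s).pow 2).sub (hQ s))).congr_deriv (by simp; ring)
  -- The constant `5 = 1 + 3 + 1` counts the three terms of the third derivative.
  have hK : ∀ s : ℝ, |sigmoidProd a (w + s • u) * (-sigmoidLin a (w + s • u) u ^ 3 +
        3 * (sigmoidLin a (w + s • u) u * sigmoidQuad a (w + s • u) u) +
        sigmoidCub a (w + s • u) u)| ≤ 5 * (∑ i, |u i|) ^ 3 := by
    intro s
    set x := w + s • u
    set m := ∑ i, |u i|
    have hm : 0 ≤ m := Finset.sum_nonneg fun _ _ => abs_nonneg _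
    have e1 : |sigmoidLin a x u ^ 3| ≤ m ^ 3 := by
      rw [abs_pow]; gcongr; exact abs_sigmoidLin_le a x u
    have e2 : |sigmoidLin a x u * sigmoidQuad a x u| ≤ m ^ 3 := by
      rw [abs_mul, abs_of_nonneg (sigmoidQuad_nonneg a x u), show m ^ 3 = m * m ^ 2 by ring]
      exact mul_le_mul (abs_sigmoidLin_le a x u) (sigmoidQuad_le a x u)
        (sigmoidQuad_nonneg a x u) hm
    have e3 : |sigmoidCub a x u| ≤ m ^ 3 := abs_sigmoidCub_le a x u
    rw [abs_mul, abs_of_nonneg (sigmoidProd_nonneg a x)]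
    refine (mul_le_of_le_one_left (abs_nonneg _) (sigmoidProd_le_one a x)).trans ?_
    rw [abs_le] at *
    constructor <;> linarith [e1.1, e1.2, e2.1, e2.2, e3.1, e3.2]
  have := abs_taylor_two_le h0 h1 h2 hK
  simp only [one_smul, zero_smul, add_zero] at this
  convert this using 2
  ring

end Slepian

/-! ### Gaussian interpolation between covariance matrices -/

section Slepian

variable {ι : Type*} [Fintype ι] [DecidableEq ι]

open Matrix WithLp

/-- By characteristic functions, `N(0, S + hA)` is the law of `w + √h u` with independent `w ~ N(0,
S)` and `u ~ N(0, A)`. -/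
lemma integral_multivariateGaussian_add {S A : Matrix ι ι ℝ} (hS : S.PosSemidef)
    (hA : A.PosSemidef) {h : ℝ} (hh : 0 ≤ h) {f : EuclideanSpace ℝ ι → ℝ} (hf : Continuous f)
    {C : ℝ} (hC : ∀ x, ‖f x‖ ≤ C) :
    ∫ x, f x ∂multivariateGaussian 0 (S + h • A) =
      ∫ w, ∫ u, f (w + √h • u) ∂multivariateGaussian 0 A ∂multivariateGaussian 0 S := by
  have e : multivariateGaussian 0 (S + h • A) =
      (multivariateGaussian 0 S).conv ((multivariateGaussian 0 A).map (fun x => √h • x)) := by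
    have : IsProbabilityMeasure ((multivariateGaussian 0 A).map (fun x => √h • x)) :=
      Measure.isProbabilityMeasure_map (by fun_prop)
    apply Measure.ext_of_charFun
    ext x
    rw [charFun_conv, charFun_map_smul, charFun_multivariateGaussian hS,
      charFun_multivariateGaussian hA, charFun_multivariateGaussian (hS.add (hA.smul hh)),
      ← Complex.exp_add]
    congr 1
    simp only [inner_zero_right, Complex.ofReal_zero, zero_mul, zero_sub, ofLp_smul,
      Matrix.add_mulVec, dotProduct_add, Matrix.smul_mulVec, dotProduct_smul, smul_dotProduct,
      Matrix.mulVec_smul, smul_eq_mul]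
    rw [← mul_assoc (√h), Real.mul_self_sqrt hh]
    push_cast
    ring
  have : IsProbabilityMeasure ((multivariateGaussian 0 A).map (fun x => √h • x)) :=
      Measure.isProbabilityMeasure_map (by fun_prop)
  rw [e, integral_conv (Integrable.of_bound (hf.aestronglyMeasurable) C (ae_of_all _ hC))]
  congr 1 with w
  rw [integral_map (by fun_prop) (by fun_prop)]

lemma integral_eval_multivariateGaussian (S : Matrix ι ι ℝ) (i : ι) :
    ∫ x, x i ∂multivariateGaussian 0 S = 0 := by
  have h := ContinuousLinearMap.integral_comp_id_comm (μ := multivariateGaussian 0 S)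
    IsGaussian.integrable_id (EuclideanSpace.proj (𝕜 := ℝ) i)
  simpa using h

lemma memLp_eval_multivariateGaussian (S : Matrix ι ι ℝ) (i : ι) :
    MemLp (fun x : EuclideanSpace ℝ ι => x i) 2 (multivariateGaussian 0 S) :=
  (EuclideanSpace.proj (𝕜 := ℝ) i).comp_memLp' IsGaussian.memLp_two_id

lemma integrable_eval_mul_eval_multivariateGaussian (S : Matrix ι ι ℝ) (i j : ι) :
    Integrable (fun x : EuclideanSpace ℝ ι => x i * x j) (multivariateGaussian 0 S) :=
  (memLp_eval_multivariateGaussian S i).integrable_mul (memLp_eval_multivariateGaussian S j)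

lemma integral_eval_mul_eval_multivariateGaussian {S : Matrix ι ι ℝ} (hS : S.PosSemidef)
    (i j : ι) : ∫ x, x i * x j ∂multivariateGaussian 0 S = S i j := by
  have h := covariance_eval_multivariateGaussian (μ := 0) hS i j
  rw [covariance_eq_sub (memLp_eval_multivariateGaussian S i)
    (memLp_eval_multivariateGaussian S j), integral_eval_multivariateGaussian] at h
  simpa using h

lemma integrable_sum_abs_pow_multivariateGaussian (S : Matrix ι ι ℝ) :
    Integrable (fun x : EuclideanSpace ℝ ι => (∑ i, |x i|) ^ 3) (multivariateGaussian 0 S) := by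
  have h3 : Integrable (fun x : EuclideanSpace ℝ ι => ‖x‖ ^ 3) (multivariateGaussian 0 S) := by
    simpa using (IsGaussian.memLp_id (multivariateGaussian 0 S) (3 : ℕ)
      (by simp)).integrable_norm_pow (p := 3) (by norm_num)
  refine (h3.const_mul ((Fintype.card ι : ℝ) ^ 3)).mono' (by fun_prop) (ae_of_all _ fun x => ?_)
  rw [Real.norm_eq_abs, abs_pow, ← mul_pow, abs_of_nonneg (Finset.sum_nonneg fun _ _ => abs_nonneg _)]
  gcongr
  calc ∑ i, |x i| ≤ ∑ _i : ι, ‖x‖ := Finset.sum_le_sum fun i _ => PiLp.norm_apply_le x i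
    _ = _ := by simp

/-- Second-order expansion of a Gaussian perturbation of `sigmoidProd`. -/
lemma abs_integral_sigmoidProd_sub_le {A : Matrix ι ι ℝ} (hA : A.PosSemidef) {h : ℝ}
    (hh : 0 ≤ h) (a : ι → ℝ) (w : EuclideanSpace ℝ ι) :
    |∫ u, sigmoidProd a (w + √h • u : EuclideanSpace ℝ ι) ∂multivariateGaussian 0 A -
      sigmoidProd a w - sigmoidProd a w * h / 2 *
        (∑ i, ∑ j, (1 - Real.sigmoid (a i - w i)) * (1 - Real.sigmoid (a j - w j)) * A i j -
          ∑ i, (Real.sigmoid (a i - w i) * (1 - Real.sigmoid (a i - w i))) * A i i)| ≤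
      √h ^ 3 * (5 * ∫ u, (∑ i, |u i|) ^ 3 ∂multivariateGaussian 0 A) := by
  set γ := multivariateGaussian (0 : EuclideanSpace ℝ ι) A
  set c : ι → ℝ := fun i => 1 - Real.sigmoid (a i - w i)
  set d : ι → ℝ := fun i => Real.sigmoid (a i - w i) * (1 - Real.sigmoid (a i - w i))
  have hcont : Continuous fun u : EuclideanSpace ℝ ι =>
      sigmoidProd a (w + √h • u : EuclideanSpace ℝ ι) :=
    (continuous_sigmoidProd a).comp (by fun_prop)
  have hi0 : Integrable (fun u : EuclideanSpace ℝ ι =>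
      sigmoidProd a (w + √h • u : EuclideanSpace ℝ ι)) γ :=
    Integrable.of_bound hcont.aestronglyMeasurable 1 (ae_of_all _ fun u => by
      rw [Real.norm_of_nonneg (sigmoidProd_nonneg _ _)]; exact sigmoidProd_le_one _ _)
  have hiL : Integrable (fun u : EuclideanSpace ℝ ι => ∑ i, u i * c i) γ :=
    integrable_finsetSum _ fun i _ =>
      ((memLp_eval_multivariateGaussian A i).integrable one_le_two).mul_const _
  have hiL2 : Integrable (fun u : EuclideanSpace ℝ ι => ∑ i, ∑ j, c i * c j * (u i * u j)) γ :=
    integrable_finsetSum _ fun i _ => integrable_finsetSum _ fun j _ =>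
      (integrable_eval_mul_eval_multivariateGaussian A i j).const_mul _
  have hiQ : Integrable (fun u : EuclideanSpace ℝ ι => ∑ i, d i * (u i * u i)) γ :=
    integrable_finsetSum _ fun i _ =>
      (integrable_eval_mul_eval_multivariateGaussian A i i).const_mul _
  have vL : ∫ u : EuclideanSpace ℝ ι, ∑ i, u i * c i ∂γ = 0 := by
    rw [integral_finsetSum _ fun i _ =>
      ((memLp_eval_multivariateGaussian A i).integrable one_le_two).mul_const _]
    simp [integral_mul_const, integral_eval_multivariateGaussian]
  have vL2 : ∫ u : EuclideanSpace ℝ ι, ∑ i, ∑ j, c i * c j * (u i * u j) ∂γ =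
      ∑ i, ∑ j, c i * c j * A i j := by
    rw [integral_finsetSum _ fun i _ => integrable_finsetSum _ fun j _ =>
      (integrable_eval_mul_eval_multivariateGaussian A i j).const_mul _]
    refine Finset.sum_congr rfl fun i _ => ?_
    rw [integral_finsetSum _ fun j _ =>
      (integrable_eval_mul_eval_multivariateGaussian A i j).const_mul _]
    simp [integral_const_mul, integral_eval_mul_eval_multivariateGaussian hA]
  have vQ : ∫ u : EuclideanSpace ℝ ι, ∑ i, d i * (u i * u i) ∂γ = ∑ i, d i * A i i := by
    rw [integral_finsetSum _ fun i _ =>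
      (integrable_eval_mul_eval_multivariateGaussian A i i).const_mul _]
    simp [integral_const_mul, integral_eval_mul_eval_multivariateGaussian hA]
  -- The Taylor remainder. Its linear term has mean zero and the second moments of `u` are the
  -- entries of `A`, so its integral is the quantity to be bounded.
  set R : EuclideanSpace ℝ ι → ℝ := fun u =>
    sigmoidProd a (w + √h • u : EuclideanSpace ℝ ι) - sigmoidProd a w +
      sigmoidProd a w * (√h * ∑ i, u i * c i) -
      sigmoidProd a w * h / 2 * (∑ i, ∑ j, c i * c j * (u i * u j) - ∑ i, d i * (u i * u i))
    with hR
  have hRb : ∀ u, ‖R u‖ ≤ √h ^ 3 * (5 * (∑ i, |u i|) ^ 3) := by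
    intro u
    have hT := abs_sigmoidProd_taylor_le a (w : ι → ℝ) (√h • (u : ι → ℝ))
    have e1 : sigmoidLin a w (√h • (u : ι → ℝ)) = √h * ∑ i, u i * c i := by
      simp [sigmoidLin, c, Finset.mul_sum, mul_assoc]
    have e2 : sigmoidQuad a w (√h • (u : ι → ℝ)) = h * ∑ i, d i * (u i * u i) := by
      simp only [sigmoidQuad, d, Finset.mul_sum, Pi.smul_apply, smul_eq_mul, mul_pow,
        Real.sq_sqrt hh]
      exact Finset.sum_congr rfl fun i _ => by ring
    have e3 : (∑ i, |(√h • (u : ι → ℝ)) i|) = √h * ∑ i, |u i| := by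
      simp [abs_mul, Finset.mul_sum, abs_of_nonneg (Real.sqrt_nonneg h)]
    have e4 : (√h * ∑ i, u i * c i) ^ 2 = h * ∑ i, ∑ j, c i * c j * (u i * u j) := by
      rw [mul_pow, Real.sq_sqrt hh, sq, Finset.sum_mul_sum]
      congr 1
      exact Finset.sum_congr rfl fun i _ => Finset.sum_congr rfl fun j _ => by ring
    rw [e1, e2, e3, e4] at hT
    rw [Real.norm_eq_abs]
    refine le_trans (le_of_eq ?_) (hT.trans (le_of_eq (by ring)))
    rw [hR]
    congr 1
    simp only [ofLp_add, ofLp_smul]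
    ring
  have hint : ∫ u, R u ∂γ = ∫ u, sigmoidProd a (w + √h • u : EuclideanSpace ℝ ι) ∂γ -
      sigmoidProd a w - sigmoidProd a w * h / 2 *
        (∑ i, ∑ j, c i * c j * A i j - ∑ i, d i * A i i) := by
    rw [hR, integral_sub, integral_add, integral_sub hi0 (integrable_const _), integral_const_mul,
      integral_const_mul, integral_const_mul, integral_sub hiL2 hiQ, vL, vL2, vQ]
    · simp
    · exact hi0.sub (integrable_const _)
    · exact (hiL.const_mul _).const_mul _
    · exact (hi0.sub (integrable_const _)).add ((hiL.const_mul _).const_mul _)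
    · exact (hiL2.sub hiQ).const_mul _
  rw [← hint, ← Real.norm_eq_abs, ← integral_const_mul, ← integral_const_mul]
  exact norm_integral_le_of_norm_le
    (((integrable_sum_abs_pow_multivariateGaussian A).const_mul _).const_mul _) (ae_of_all _ hRb)

/-- One step of the interpolation between two covariance matrices. -/
lemma integral_sigmoidProd_step {A B : Matrix ι ι ℝ} (hA : A.PosSemidef) (hB : B.PosSemidef)
    (hdiag : ∀ i, A i i = B i i) (hle : ∀ i j, A i j ≤ B i j) (a : ι → ℝ) :
    ∃ C : ℝ, ∀ W : Matrix ι ι ℝ, W.PosSemidef → ∀ h : ℝ, 0 ≤ h →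
      ∫ x : EuclideanSpace ℝ ι, sigmoidProd a x ∂multivariateGaussian 0 (W + h • A) -
        √h ^ 3 * C ≤
      ∫ x : EuclideanSpace ℝ ι, sigmoidProd a x ∂multivariateGaussian 0 (W + h • B) := by
  refine ⟨5 * ∫ u, (∑ i, |u i|) ^ 3 ∂multivariateGaussian (0 : EuclideanSpace ℝ ι) A +
    5 * ∫ u, (∑ i, |u i|) ^ 3 ∂multivariateGaussian (0 : EuclideanSpace ℝ ι) B,
    fun W hW h hh => ?_⟩
  have hcont : Continuous fun x : EuclideanSpace ℝ ι => sigmoidProd a x :=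
    (continuous_sigmoidProd a).comp (by fun_prop)
  have hbd : ∀ x : EuclideanSpace ℝ ι, ‖sigmoidProd a x‖ ≤ 1 := fun x => by
    rw [Real.norm_of_nonneg (sigmoidProd_nonneg _ _)]; exact sigmoidProd_le_one _ _
  rw [integral_multivariateGaussian_add hW hA hh hcont hbd,
    integral_multivariateGaussian_add hW hB hh hcont hbd]
  have hI : ∀ S : Matrix ι ι ℝ, Integrable (fun w : EuclideanSpace ℝ ι =>
      ∫ u, sigmoidProd a (w + √h • u : EuclideanSpace ℝ ι) ∂multivariateGaussian 0 S)
      (multivariateGaussian 0 W) := by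
    intro S
    refine Integrable.of_bound ?_ 1 (ae_of_all _ fun w => ?_)
    · refine AEStronglyMeasurable.integral_prod_right'
        (f := fun p : EuclideanSpace ℝ ι × EuclideanSpace ℝ ι =>
          sigmoidProd a (p.1 + √h • p.2 : EuclideanSpace ℝ ι)) ?_
      exact Continuous.aestronglyMeasurable (hcont.comp (by fun_prop))
    · refine (norm_integral_le_of_norm_le_const (C := 1) (ae_of_all _ fun u => hbd _)).trans ?_
      simp
  have hpt : ∀ w : EuclideanSpace ℝ ι,
      ∫ u, sigmoidProd a (w + √h • u : EuclideanSpace ℝ ι) ∂multivariateGaussian 0 A -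
        √h ^ 3 * (5 * ∫ u, (∑ i, |u i|) ^ 3 ∂multivariateGaussian (0 : EuclideanSpace ℝ ι) A +
    5 * ∫ u, (∑ i, |u i|) ^ 3 ∂multivariateGaussian (0 : EuclideanSpace ℝ ι) B) ≤
      ∫ u, sigmoidProd a (w + √h • u : EuclideanSpace ℝ ι) ∂multivariateGaussian 0 B := by
    intro w
    have h1 := (abs_le.1 (abs_integral_sigmoidProd_sub_le hA hh a w)).2
    have h2 := (abs_le.1 (abs_integral_sigmoidProd_sub_le hB hh a w)).1
    -- The second-order term of negative sign involves only the diagonal, where the matrices agree;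
    -- the other one has non-negative coefficients and is monotone in the matrix.
    have h3 : ∑ i, (Real.sigmoid (a i - w i) * (1 - Real.sigmoid (a i - w i))) * A i i =
        ∑ i, (Real.sigmoid (a i - w i) * (1 - Real.sigmoid (a i - w i))) * B i i := by
      simp only [hdiag]
    have h4 : ∑ i, ∑ j, (1 - Real.sigmoid (a i - w i)) * (1 - Real.sigmoid (a j - w j)) * A i j ≤
        ∑ i, ∑ j, (1 - Real.sigmoid (a i - w i)) * (1 - Real.sigmoid (a j - w j)) * B i j := by
      refine Finset.sum_le_sum fun i _ => Finset.sum_le_sum fun j _ =>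
        mul_le_mul_of_nonneg_left (hle i j) (mul_nonneg ?_ ?_) <;>
      exact sub_nonneg.2 (Real.sigmoid_le_one _)
    have h5 : 0 ≤ sigmoidProd a w * h / 2 := by
      have := sigmoidProd_nonneg a w
      positivity
    have h6 := mul_le_mul_of_nonneg_left (sub_le_sub_right h4
      (∑ i, (Real.sigmoid (a i - w i) * (1 - Real.sigmoid (a i - w i))) * A i i)) h5
    rw [h3] at h1 h6
    linarith
  have := integral_mono ((hI A).sub (integrable_const _)) (hI B) hpt
  rw [Pi.sub_def, integral_sub (hI A) (integrable_const _)] at this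
  simpa using this

/-- Going from `A` to `B` in `1 / h` steps of size `h` costs at most `h ^ (3 / 2) * C` per step,
hence `√h * C` in total, which vanishes with `h`. This replaces differentiation along the
interpolation. -/
lemma integral_sigmoidProd_le {A B : Matrix ι ι ℝ} (hA : A.PosSemidef) (hB : B.PosSemidef)
    (hdiag : ∀ i, A i i = B i i) (hle : ∀ i j, A i j ≤ B i j) (a : ι → ℝ) :
    ∫ x : EuclideanSpace ℝ ι, sigmoidProd a x ∂multivariateGaussian 0 A ≤
      ∫ x : EuclideanSpace ℝ ι, sigmoidProd a x ∂multivariateGaussian 0 B := by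
  obtain ⟨C, hC⟩ := integral_sigmoidProd_step hA hB hdiag hle a
  set G : Matrix ι ι ℝ → ℝ := fun S =>
    ∫ x : EuclideanSpace ℝ ι, sigmoidProd a x ∂multivariateGaussian 0 S
  have hn : ∀ n : ℕ, G A - √((n : ℝ) + 1)⁻¹ * C ≤ G B := by
    intro n
    set h : ℝ := ((n : ℝ) + 1)⁻¹ with hdef
    have hpos : 0 < h := by positivity
    have hmul : ((n : ℝ) + 1) * h = 1 := mul_inv_cancel₀ (by positivity)
    have key : ∀ k : ℕ, k ≤ n + 1 →
        G A - k * (√h ^ 3 * C) ≤ G ((1 - k * h) • A + (k * h) • B) := by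
      intro k
      induction k with
      | zero => intro _; simp
      | succ k ih =>
        intro hk
        have hk1 : ((k : ℝ) + 1) * h ≤ 1 := by
          refine le_of_le_of_eq (mul_le_mul_of_nonneg_right ?_ hpos.le) hmul
          exact_mod_cast hk
        have := hC ((1 - (k + 1) * h) • A + (k * h) • B)
          ((hA.smul (sub_nonneg.2 hk1)).add (hB.smul (by positivity))) h hpos.le
        -- The `k`-th and `(k + 1)`-st points share a positive semidefinite part, to which `h • A`
        -- or `h • B` is added.
        have e1 : (1 - (k + 1) * h) • A + (k * h) • B + h • A =
          (1 - k * h) • A + (k * h) • B := by module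
        have e2 : (1 - (k + 1) * h) • A + (k * h) • B + h • B =
          (1 - ((k + 1 : ℕ) : ℝ) * h) • A + (((k + 1 : ℕ) : ℝ) * h) • B := by push_cast; module
        rw [e1, e2] at this
        have := ih (by omega)
        simp only [G] at *
        push_cast at *
        linarith
    have := key (n + 1) le_rfl
    push_cast at this
    rw [hmul] at this
    simp only [sub_self, zero_smul, one_smul, zero_add] at this
    have e : ((n : ℝ) + 1) * (√h ^ 3 * C) = √h * C := by
      rw [pow_succ, Real.sq_sqrt hpos.le]
      linear_combination √h * C * hmul
    linarith
  have hlim : Tendsto (fun n : ℕ => G A - √((n : ℝ) + 1)⁻¹ * C) atTop (𝓝 (G A - √0 * C)) := by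
    refine tendsto_const_nhds.sub (Tendsto.mul_const _ ?_)
    refine (Real.continuous_sqrt.tendsto 0).comp ?_
    simpa using tendsto_one_div_add_atTop_nhds_zero_nat (𝕜 := ℝ)
  simpa using le_of_tendsto' hlim hn

end Slepian

/-! ### Slepian's inequality for random vectors -/

section Slepian

variable {ι : Type*} [Fintype ι] [DecidableEq ι]

open Matrix WithLp

/-- The covariance matrix of a random vector. -/
def covMatrix {Ω : Type*} [MeasurableSpace Ω] (X : ι → Ω → ℝ) (P : Measure Ω) : Matrix ι ι ℝ :=
  Matrix.of fun i j => cov[X i, X j; P]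

section

variable {Ω : Type*} [MeasurableSpace Ω] {P : Measure Ω} {X : ι → Ω → ℝ}

omit [DecidableEq ι] in
lemma variance_sum_mul (hX : HasGaussianLaw (fun ω i => X i ω) P) (c : ι → ℝ) :
    Var[fun ω => ∑ i, c i * X i ω; P] = ∑ i, ∑ j, c i * c j * cov[X i, X j; P] := by
  have := hX.isProbabilityMeasure
  have h := variance_fun_sum (μ := P) (X := fun i ω => c i * X i ω)
    fun i => (hX.eval i).memLp_two.const_mul (c i)
  rw [h]
  refine Finset.sum_congr rfl fun i _ => Finset.sum_congr rfl fun j _ => ?_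
  rw [covariance_const_mul_left, covariance_const_mul_right, mul_assoc]

omit [DecidableEq ι] in
lemma posSemidef_covMatrix (hX : HasGaussianLaw (fun ω i => X i ω) P) :
    (covMatrix X P).PosSemidef := by
  refine Matrix.PosSemidef.of_dotProduct_mulVec_nonneg ?_ fun c => ?_
  · ext i j
    simp [covMatrix, covariance_comm]
  · have h := variance_nonneg (fun ω => ∑ i, c i * X i ω) P
    rw [variance_sum_mul hX] at h
    simpa [dotProduct, Matrix.mulVec, covMatrix, Finset.mul_sum, mul_assoc, mul_left_comm,
      mul_comm] using h

lemma map_toLp_eq_multivariateGaussian (hX : HasGaussianLaw (fun ω i => X i ω) P)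
    (h0 : ∀ i, ∫ ω, X i ω ∂P = 0) :
    P.map (fun ω => toLp 2 (X · ω)) = multivariateGaussian 0 (covMatrix X P) := by
  have hP := hX.isProbabilityMeasure
  have hL := hX.toLp_pi 2
  have := hL.isGaussian_map
  apply Measure.ext_of_charFun
  ext t
  rw [hL.charFun_map_eq, charFun_multivariateGaussian (posSemidef_covMatrix hX)]
  have e : ∀ ω, inner ℝ t (toLp 2 (X · ω)) = ∑ i, t i * X i ω := fun ω => by
    simp [PiLp.inner_apply, mul_comm]
  simp only [e]
  rw [variance_sum_mul hX, integral_finsetSum _ fun i _ => (hX.eval i).integrable.const_mul _]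
  simp only [integral_const_mul, h0]
  congr 2
  · simp
  · congr 2
    simp only [dotProduct, Matrix.mulVec, covMatrix, Finset.mul_sum, Matrix.of_apply]
    exact Finset.sum_congr rfl fun i _ => Finset.sum_congr rfl fun j _ => by ring

end

variable {Ω Ω' : Type*} [MeasurableSpace Ω] [MeasurableSpace Ω'] {P : Measure Ω} {P' : Measure Ω'}
  {X : ι → Ω → ℝ} {Y : ι → Ω' → ℝ}

omit [DecidableEq ι] in
lemma integral_sigmoidProd_comp_le (hX : HasGaussianLaw (fun ω i => X i ω) P)
    (hX0 : ∀ i, ∫ ω, X i ω ∂P = 0) (hY : HasGaussianLaw (fun ω i => Y i ω) P')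
    (hY0 : ∀ i, ∫ ω, Y i ω ∂P' = 0) (hvar : ∀ i, Var[X i; P] = Var[Y i; P'])
    (hcov : ∀ i j, cov[X i, X j; P] ≤ cov[Y i, Y j; P']) (a : ι → ℝ) :
    ∫ ω, sigmoidProd a (X · ω) ∂P ≤ ∫ ω, sigmoidProd a (Y · ω) ∂P' := by
  classical
  have h := integral_sigmoidProd_le (posSemidef_covMatrix hX) (posSemidef_covMatrix hY)
    (fun i => by
      simp only [covMatrix, Matrix.of_apply]
      rw [covariance_self (hX.eval i).aemeasurable, covariance_self (hY.eval i).aemeasurable,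
        hvar]) hcov a
  have hc : Continuous fun x : EuclideanSpace ℝ ι => sigmoidProd a x :=
    (continuous_sigmoidProd a).comp (by fun_prop)
  rwa [← map_toLp_eq_multivariateGaussian hX hX0, ← map_toLp_eq_multivariateGaussian hY hY0,
    integral_map (hX.toLp_pi 2).aemeasurable hc.aestronglyMeasurable,
    integral_map (hY.toLp_pi 2).aemeasurable hc.aestronglyMeasurable] at h

omit [DecidableEq ι] in
lemma nullMeasurableSet_forall_le (hX : ∀ i, AEMeasurable (X i) P) (c : ι → ℝ) :
    NullMeasurableSet {ω | ∀ i, X i ω ≤ c i} P := by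
  rw [Set.ofPred_forall]
  exact NullMeasurableSet.iInter fun i => nullMeasurableSet_le (hX i) aemeasurable_const

-- The factors are `σ (n + n² (c i - X i))`: the slope `n²` beats the shift `n` when `X i > c i`,
-- and the shift makes the limit `1` also at `X i = c i`, so that the closed orthant appears.
omit [DecidableEq ι] in
lemma tendsto_integral_sigmoidProd [IsProbabilityMeasure P] (hX : ∀ i, AEMeasurable (X i) P)
    (c : ι → ℝ) :
    Tendsto (fun n : ℕ => ∫ ω, sigmoidProd (fun i => (n : ℝ) + (n : ℝ) ^ 2 * c i)
      (fun i => (n : ℝ) ^ 2 * X i ω) ∂P) atTop (𝓝 (P.real {ω | ∀ i, X i ω ≤ c i})) := by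
  have hlim : ∀ y : ℝ, Tendsto (fun n : ℕ => Real.sigmoid (n + n ^ 2 * 0 - n ^ 2 * y)) atTop
      (𝓝 (if y ≤ 0 then 1 else 0)) := by
    intro y
    have hn : Tendsto (fun n : ℕ => (n : ℝ)) atTop atTop := tendsto_natCast_atTop_atTop
    split_ifs with hy
    · refine Real.tendsto_sigmoid_atTop.comp (tendsto_atTop_mono (fun n => ?_) hn)
      nlinarith [mul_nonneg (sq_nonneg (n : ℝ)) (neg_nonneg.2 hy)]
    · refine Real.tendsto_sigmoid_atBot.comp ?_
      have h1 : Tendsto (fun n : ℕ => (n : ℝ) * y + -1) atTop atTop :=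
        tendsto_atTop_add_const_right _ _ (hn.atTop_mul_const (not_le.1 hy))
      refine (tendsto_neg_atTop_atBot.comp (hn.atTop_mul_atTop₀ h1)).congr fun n => ?_
      simp only [Function.comp]
      ring
  have hint : P.real {ω | ∀ i, X i ω ≤ c i} =
      ∫ ω, Set.indicator {ω | ∀ i, X i ω ≤ c i} (fun _ => (1 : ℝ)) ω ∂P := by
    rw [integral_indicator₀ (nullMeasurableSet_forall_le hX c)]
    simp
  rw [hint]
  refine tendsto_integral_of_dominated_convergence (fun _ => 1) (fun n => ?_) (integrable_const _)
    (fun n => ae_of_all _ fun ω => ?_) (ae_of_all _ fun ω => ?_)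
  · refine AEMeasurable.aestronglyMeasurable ?_
    exact (continuous_sigmoidProd _).measurable.comp_aemeasurable
      (aemeasurable_pi_lambda _ fun i => (hX i).const_mul _)
  · rw [Real.norm_of_nonneg (sigmoidProd_nonneg _ _)]
    exact sigmoidProd_le_one _ _
  · have h1 := tendsto_finsetProd Finset.univ fun i _ => hlim (X i ω - c i)
    have e : Set.indicator {ω | ∀ i, X i ω ≤ c i} (fun _ => (1 : ℝ)) ω =
        ∏ i, if X i ω - c i ≤ 0 then (1 : ℝ) else 0 := by
      simp only [Set.indicator, Set.mem_ofPred_eq, sub_nonpos]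
      split_ifs with h
      · simp [h]
      · push Not at h
        obtain ⟨i, hi⟩ := h
        exact (Finset.prod_eq_zero (Finset.mem_univ i) (by simp [hi])).symm
    rw [e]
    refine h1.congr fun n => Finset.prod_congr rfl fun i _ => ?_
    congr 1
    ring

omit [DecidableEq ι] in
/-- **Slepian's inequality** for centered Gaussian vectors. -/
theorem slepian (hX : HasGaussianLaw (fun ω i => X i ω) P)
    (hX0 : ∀ i, ∫ ω, X i ω ∂P = 0) (hY : HasGaussianLaw (fun ω i => Y i ω) P')
    (hY0 : ∀ i, ∫ ω, Y i ω ∂P' = 0) (hvar : ∀ i, Var[X i; P] = Var[Y i; P'])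
    (hcov : ∀ i j, cov[X i, X j; P] ≤ cov[Y i, Y j; P']) (c : ι → ℝ) :
    P {ω | ∀ i, X i ω ≤ c i} ≤ P' {ω | ∀ i, Y i ω ≤ c i} := by
  have hP := hX.isProbabilityMeasure
  have hP' := hY.isProbabilityMeasure
  rw [← ENNReal.toReal_le_toReal (measure_ne_top _ _) (measure_ne_top _ _)]
  refine le_of_tendsto_of_tendsto'
    (tendsto_integral_sigmoidProd (fun i => (hX.eval i).aemeasurable) c)
    (tendsto_integral_sigmoidProd (fun i => (hY.eval i).aemeasurable) c) fun n => ?_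
  have hX' : HasGaussianLaw (fun ω i => (n : ℝ) ^ 2 * X i ω) P := hX.smul ((n : ℝ) ^ 2)
  have hY' : HasGaussianLaw (fun ω i => (n : ℝ) ^ 2 * Y i ω) P' := hY.smul ((n : ℝ) ^ 2)
  refine integral_sigmoidProd_comp_le (X := fun i ω => (n : ℝ) ^ 2 * X i ω)
    (Y := fun i ω => (n : ℝ) ^ 2 * Y i ω) hX' (fun i => ?_) hY' (fun i => ?_) (fun i => ?_)
    (fun i j => ?_) _
  · rw [integral_const_mul, hX0, mul_zero]
  · rw [integral_const_mul, hY0, mul_zero]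
  · rw [variance_const_mul, variance_const_mul, hvar]
  · simp only [covariance_const_mul_left, covariance_const_mul_right]
    have := hcov i j
    gcongr

end Slepian

lemma _root_.ProbabilityTheory.HasGaussianLaw.comp_measurePreserving {Ω Ω' E : Type*}
    [MeasurableSpace Ω] [MeasurableSpace Ω'] [TopologicalSpace E] [AddCommMonoid E] [Module ℝ E]
    [MeasurableSpace E] {P : Measure Ω} {Q : Measure Ω'} {X : Ω → E} {f : Ω' → Ω}
    (hX : HasGaussianLaw X P) (hf : MeasurePreserving f Q P) :
    HasGaussianLaw (fun ω => X (f ω)) Q where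
  isGaussian_map := by
    have h : Q.map (fun ω => X (f ω)) = P.map X := by
      rw [← hf.map_eq, AEMeasurable.map_map_of_aemeasurable _ hf.measurable.aemeasurable]
      · rfl
      · rw [hf.map_eq]
        -- A push-forward along a function that is not a.e. measurable is zero by convention, but a
        -- Gaussian law has mass one.
        exact AEMeasurable.of_map_ne_zero hX.isGaussian_map.toIsProbabilityMeasure.ne_zero
    rw [h]
    exact hX.isGaussian_map

lemma covariance_comp_measurePreserving {Ω Ω' : Type*} [MeasurableSpace Ω] [MeasurableSpace Ω']
    {P : Measure Ω} {Q : Measure Ω'} {X Y : Ω → ℝ} {f : Ω' → Ω} (hX : AEMeasurable X P)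
    (hY : AEMeasurable Y P) (hf : MeasurePreserving f Q P) :
    cov[fun ω => X (f ω), fun ω => Y (f ω); Q] = cov[X, Y; P] := by
  have e := hf.map_eq
  subst e
  rw [covariance_map hX.aestronglyMeasurable hY.aestronglyMeasurable hf.aemeasurable]
  rfl

lemma hasGaussianLaw_comp {T ι Ω : Type*} [Finite ι] [MeasurableSpace Ω] {μ : Measure Ω}
    {Z : T → Ω → ℝ} (hZ : IsGaussianProcess Z μ) (f : ι → T) :
    HasGaussianLaw (fun ω i => Z (f i) ω) μ := by
  classical
  have := Fintype.ofFinite ι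
  let L : (Finset.univ.image f → ℝ) →L[ℝ] (ι → ℝ) :=
    ContinuousLinearMap.pi fun i => ContinuousLinearMap.proj ⟨f i, by simp⟩
  exact (hZ.hasGaussianLaw (Finset.univ.image f)).map_fun L

lemma forall_sigma_finset {T κ : Type*} {F : κ → Finset T} {p : κ → T → Prop} :
    (∀ q : Σ i, F i, p q.1 q.2) ↔ ∀ i, ∀ t ∈ F i, p i t :=
  ⟨fun h i t ht => h ⟨i, t, ht⟩, fun h q => h q.1 q.2 q.2.2⟩

/-! ### Comparison with independent blocks -/

section Blocks

variable {T κ Ω : Type*} [Fintype κ] [DecidableEq κ] [MeasurableSpace Ω] {μ : Measure Ω}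
  {Z : T → Ω → ℝ} {F : κ → Finset T} {B : Matrix κ κ ℝ}

/-- Independent copies of the restrictions of `Z` to finite blocks, mixed with a Gaussian vector
that is constant on each block. -/
def blockProcess (Z : T → Ω → ℝ) (F : κ → Finset T) (a b : ℝ) (p : Σ i, F i)
    (ω : (κ → Ω) × EuclideanSpace ℝ κ) : ℝ :=
  a * Z p.2 (ω.1 p.1) + b * ω.2 p.1

/-- The probability space carrying `blockProcess`. -/
def blockMeasure (μ : Measure Ω) (B : Matrix κ κ ℝ) : Measure ((κ → Ω) × EuclideanSpace ℝ κ) :=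
  (Measure.pi fun _ => μ).prod (multivariateGaussian 0 B)

lemma hasGaussianLaw_eval_multivariateGaussian :
    HasGaussianLaw (fun x : EuclideanSpace ℝ κ => fun i => x i) (multivariateGaussian 0 B) :=
  (IsGaussian.hasGaussianLaw_id (μ := multivariateGaussian 0 B)).map_equiv
    (PiLp.continuousLinearEquiv 2 ℝ fun _ : κ => ℝ)

lemma hasGaussianLaw_blockProcess (hZ : IsGaussianProcess Z μ) (a b : ℝ) :
    HasGaussianLaw (fun ω p => blockProcess Z F a b p ω) (blockMeasure μ B) := by
  have := hZ.isProbabilityMeasure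
  have h1 : HasGaussianLaw (fun (ω : κ → Ω) (i : κ) => (F i).restrict (Z · (ω i)))
      (Measure.pi fun _ => μ) := by
    refine iIndepFun.hasGaussianLaw
      (X := fun (i : κ) (ω : κ → Ω) => (F i).restrict (Z · (ω i))) (fun i => ?_) ?_
    · exact (hZ.hasGaussianLaw (F i)).comp_measurePreserving (measurePreserving_eval _ i)
    · exact iIndepFun_pi (X := fun (i : κ) (ω : Ω) => (F i).restrict (Z · ω))
        fun i => (hZ.hasGaussianLaw (F i)).aemeasurable
  have h2 := hasGaussianLaw_eval_multivariateGaussian (B := B)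
  have h3 := IndepFun.hasGaussianLaw
    (h1.comp_measurePreserving (measurePreserving_fst (ν := multivariateGaussian 0 B)))
    (h2.comp_measurePreserving (measurePreserving_snd (μ := Measure.pi fun _ : κ => μ)))
    (indepFun_prod₀ h1.aemeasurable h2.aemeasurable)
  let L : ((i : κ) → F i → ℝ) × (κ → ℝ) →L[ℝ] ((Σ i, F i) → ℝ) :=
    ContinuousLinearMap.pi fun p =>
      a • ((ContinuousLinearMap.proj p.2).comp ((ContinuousLinearMap.proj (R := ℝ)
        (φ := fun i : κ => F i → ℝ) p.1).comp (ContinuousLinearMap.fst ℝ _ _))) +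
      b • ((ContinuousLinearMap.proj p.1).comp (ContinuousLinearMap.snd ℝ _ _))
  exact h3.map_fun L

lemma integral_blockProcess (hZ : IsGaussianProcess Z μ) (h0 : ∀ t, ∫ ω, Z t ω ∂μ = 0) (a b : ℝ)
    (p : Σ i, F i) : ∫ ω, blockProcess Z F a b p ω ∂blockMeasure μ B = 0 := by
  have := hZ.isProbabilityMeasure
  have hf : MeasurePreserving (fun ω : (κ → Ω) × EuclideanSpace ℝ κ => ω.1 p.1)
      (blockMeasure μ B) μ :=
    (measurePreserving_eval _ p.1).comp measurePreserving_fst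
  have hs : MeasurePreserving (fun ω : (κ → Ω) × EuclideanSpace ℝ κ => ω.2)
      (blockMeasure μ B) (multivariateGaussian 0 B) := measurePreserving_snd
  have i1 : Integrable (fun ω : (κ → Ω) × EuclideanSpace ℝ κ => Z p.2 (ω.1 p.1))
      (blockMeasure μ B) := ((hZ.hasGaussianLaw_eval p.2).comp_measurePreserving hf).integrable
  have i2 : Integrable (fun ω : (κ → Ω) × EuclideanSpace ℝ κ => ω.2 p.1) (blockMeasure μ B) :=
    ((hasGaussianLaw_eval_multivariateGaussian.eval p.1).comp_measurePreserving hs).integrable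
  unfold blockProcess
  rw [integral_add (i1.const_mul _) (i2.const_mul _), integral_const_mul, integral_const_mul]
  have e1 := integral_map hf.aemeasurable
    (f := Z p.2) (by rw [hf.map_eq]; exact (hZ.aemeasurable p.2).aestronglyMeasurable)
  have e2 := integral_map hs.aemeasurable (f := fun x : EuclideanSpace ℝ κ => x p.1) (by fun_prop)
  rw [← e1, ← e2, hf.map_eq, hs.map_eq, h0, integral_eval_multivariateGaussian]
  simp

lemma covariance_blockProcess (hZ : IsGaussianProcess Z μ) (hB : B.PosSemidef) (a b : ℝ)
    (p q : Σ i, F i) :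
    cov[blockProcess Z F a b p, blockProcess Z F a b q; blockMeasure μ B] =
      (if p.1 = q.1 then a ^ 2 * cov[Z p.2, Z q.2; μ] else 0) + b ^ 2 * B p.1 q.1 := by
  have := hZ.isProbabilityMeasure
  have : IsProbabilityMeasure (blockMeasure μ B) := by unfold blockMeasure; infer_instance
  have hf : ∀ i, MeasurePreserving (fun ω : (κ → Ω) × EuclideanSpace ℝ κ => ω.1 i)
      (blockMeasure μ B) μ := fun i =>
    (measurePreserving_eval _ i).comp measurePreserving_fst
  have hs : MeasurePreserving (fun ω : (κ → Ω) × EuclideanSpace ℝ κ => ω.2)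
      (blockMeasure μ B) (multivariateGaussian 0 B) := measurePreserving_snd
  have i1 : ∀ (i : κ) (t : T), MemLp (fun ω : (κ → Ω) × EuclideanSpace ℝ κ => Z t (ω.1 i)) 2
      (blockMeasure μ B) := fun i t =>
    ((hZ.hasGaussianLaw_eval t).comp_measurePreserving (hf i)).memLp_two
  have i2 : ∀ i : κ, MemLp (fun ω : (κ → Ω) × EuclideanSpace ℝ κ => ω.2 i) 2
      (blockMeasure μ B) := fun i =>
    ((hasGaussianLaw_eval_multivariateGaussian.eval i).comp_measurePreserving hs).memLp_two
  have c12 : ∀ (i j : κ) (t : T), cov[fun ω : (κ → Ω) × EuclideanSpace ℝ κ => Z t (ω.1 i),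
      fun ω => ω.2 j; blockMeasure μ B] = 0 := by
    intro i j t
    refine IndepFun.covariance_eq_zero ?_ (i1 i t) (i2 j)
    exact indepFun_prod₀ (X := fun ω : κ → Ω => Z t (ω i))
      (Y := fun x : EuclideanSpace ℝ κ => x j)
      ((hZ.aemeasurable t).comp_quasiMeasurePreserving
        (Measure.quasiMeasurePreserving_eval _ i)) (by fun_prop)
  have c11 : cov[fun ω : (κ → Ω) × EuclideanSpace ℝ κ => Z p.2 (ω.1 p.1),
      fun ω => Z q.2 (ω.1 q.1); blockMeasure μ B] =
      if p.1 = q.1 then cov[Z p.2, Z q.2; μ] else 0 := by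
    split_ifs with h
    · simp only [h]
      exact covariance_comp_measurePreserving (hZ.aemeasurable _) (hZ.aemeasurable _) (hf q.1)
    -- An auxiliary family, one function per coordinate, taking the two wanted values at `p.1` and
    -- `q.1`; pairwise independence is read off from it.
    · have hi : iIndepFun (fun (r : κ) (ω : κ → Ω) =>
          if r = p.1 then Z p.2 (ω r) else Z q.2 (ω r)) (Measure.pi fun _ => μ) :=
        iIndepFun_pi (X := fun (r : κ) (ω : Ω) => if r = p.1 then Z p.2 ω else Z q.2 ω)
          fun r => by split_ifs <;> exact hZ.aemeasurable _
      have hi2 := hi.indepFun h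
      simp only [if_true, if_neg (Ne.symm h)] at hi2
      have e := covariance_comp_measurePreserving (P := Measure.pi fun _ : κ => μ)
        (X := fun ω => Z p.2 (ω p.1)) (Y := fun ω => Z q.2 (ω q.1))
        (Q := blockMeasure μ B) (f := Prod.fst)
        ((hZ.aemeasurable _).comp_quasiMeasurePreserving
          (Measure.quasiMeasurePreserving_eval _ _))
        ((hZ.aemeasurable _).comp_quasiMeasurePreserving
          (Measure.quasiMeasurePreserving_eval _ _)) measurePreserving_fst
      rw [e]
      exact hi2.covariance_eq_zero
        ((hZ.hasGaussianLaw_eval _).comp_measurePreserving (measurePreserving_eval _ _)).memLp_two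
        ((hZ.hasGaussianLaw_eval _).comp_measurePreserving (measurePreserving_eval _ _)).memLp_two
  have c22 : cov[fun ω : (κ → Ω) × EuclideanSpace ℝ κ => ω.2 p.1, fun ω => ω.2 q.1;
      blockMeasure μ B] = B p.1 q.1 := by
    rw [← covariance_eval_multivariateGaussian (μ := 0) hB p.1 q.1]
    exact covariance_comp_measurePreserving (X := fun x : EuclideanSpace ℝ κ => x p.1)
      (Y := fun x : EuclideanSpace ℝ κ => x q.1) (by fun_prop) (by fun_prop) hs
  have e : ∀ r : Σ i, F i, blockProcess Z F a b r =
      (fun ω => a * Z r.2 (ω.1 r.1)) + fun ω => b * ω.2 r.1 := fun r => rfl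
  rw [e, e, covariance_add_left ((i1 _ _).const_mul _) ((i2 _).const_mul _)
      (((i1 _ _).const_mul _).add ((i2 _).const_mul _)),
    covariance_add_right ((i1 _ _).const_mul _) ((i1 _ _).const_mul _) ((i2 _).const_mul _),
    covariance_add_right ((i2 _).const_mul _) ((i1 _ _).const_mul _) ((i2 _).const_mul _)]
  simp only [covariance_const_mul_left, covariance_const_mul_right]
  have c21 : ∀ (i j : κ) (t : T), cov[fun ω : (κ → Ω) × EuclideanSpace ℝ κ => ω.2 j,
      fun ω => Z t (ω.1 i); blockMeasure μ B] = 0 := fun i j t => by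
    rw [covariance_comm]
    exact c12 i j t
  rw [c11, c12, c22, c21]
  split_ifs <;> ring

/-- Non-negative correlations make lower orthant events of disjoint blocks positively dependent. -/
lemma prod_measure_le_measure_blocks (hZ : IsGaussianProcess Z μ) (h0 : ∀ t, ∫ ω, Z t ω ∂μ = 0)
    (hcov : ∀ s t, 0 ≤ cov[Z s, Z t; μ]) (c : ℝ) :
    ∏ i, μ {ω | ∀ t ∈ F i, Z t ω ≤ c} ≤ μ {ω | ∀ i, ∀ t ∈ F i, Z t ω ≤ c} := by
  have := hZ.isProbabilityMeasure
  have hB : (1 : Matrix κ κ ℝ).PosSemidef := Matrix.PosSemidef.one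
  have hY : HasGaussianLaw (fun ω (p : Σ i, F i) => Z p.2 ω) μ := hasGaussianLaw_comp hZ _
  have h := slepian (hasGaussianLaw_blockProcess (F := F) (B := 1) hZ 1 0)
    (integral_blockProcess hZ h0 1 0) hY (fun p => h0 p.2)
    (fun p => by
      rw [← covariance_self (hY.eval p).aemeasurable, ← covariance_self
        ((hasGaussianLaw_blockProcess (F := F) (B := 1) hZ 1 0).eval p).aemeasurable,
        covariance_blockProcess hZ hB]
      simp)
    (fun p q => by
      rw [covariance_blockProcess hZ hB]
      split_ifs
      · simp
      · simpa using hcov _ _) (fun _ => c)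
  refine le_trans ?_ (h.trans (le_of_eq ?_))
  · have e : {ω : (κ → Ω) × EuclideanSpace ℝ κ | ∀ p, blockProcess Z F 1 0 p ω ≤ c} =
        (Set.univ.pi fun i => {ω | ∀ t ∈ F i, Z t ω ≤ c}) ×ˢ Set.univ := by
      ext ω
      simp [blockProcess, Set.mem_pi,
        forall_sigma_finset (F := F) (p := fun i t => Z t (ω.1 i) ≤ c)]
    rw [e, blockMeasure, Measure.prod_prod, Measure.pi_pi]
    simp
  · congr 1
    ext ω
    exact forall_sigma_finset (F := F) (p := fun _ t => Z t ω ≤ c)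

/-- Chernoff's bound for `-∑ i ∈ S, ν i`, whose variance is at most `2 * S.card` by the row sums.
The parameter `x / 2` gives the exponent `-x² / 2 + x² / 4` per element of `S`. -/
lemma measure_forall_le_neg_le (hB : B.PosSemidef) (hB0 : ∀ i j, 0 ≤ B i j)
    (hB2 : ∀ i, ∑ j, B i j ≤ 2) (S : Finset κ) {x : ℝ} (hx : 0 ≤ x) :
    multivariateGaussian 0 B {ν | ∀ i ∈ S, ν i ≤ -x} ≤
      ENNReal.ofReal (Real.exp (-x ^ 2 / 4)) ^ S.card := by
  set γ := multivariateGaussian (0 : EuclideanSpace ℝ κ) B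
  set c : κ → ℝ := fun i => if i ∈ S then -1 else 0 with hc
  have hG := hasGaussianLaw_eval_multivariateGaussian (B := B)
  have hY : HasGaussianLaw (fun ν : EuclideanSpace ℝ κ => ∑ i, c i * ν i) γ :=
    hG.map_fun (∑ i, c i • ContinuousLinearMap.proj (R := ℝ) (φ := fun _ : κ => ℝ) i) |>.congr
      (ae_of_all _ fun ν => by simp)
  have hmean : ∫ ν, ∑ i, c i * ν i ∂γ = 0 := by
    rw [integral_finsetSum _ fun i _ => (hG.eval i).integrable.const_mul _]
    simp only [integral_const_mul, integral_eval_multivariateGaussian, mul_zero,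
      Finset.sum_const_zero]
  have hvar : Var[fun ν : EuclideanSpace ℝ κ => ∑ i, c i * ν i; γ] ≤ 2 * S.card := by
    rw [variance_sum_mul hG c]
    simp only [covariance_eval_multivariateGaussian hB]
    calc ∑ i, ∑ j, c i * c j * B i j ≤ ∑ i, if i ∈ S then 2 else 0 := by
          refine Finset.sum_le_sum fun i _ => ?_
          simp only [hc]
          split_ifs with hi
          · refine le_trans (Finset.sum_le_sum fun j _ => ?_) (hB2 i)
            have := hB0 i j
            split_ifs <;> linarith
          · simp
      _ = 2 * S.card := by simp [mul_comm]
  have hlaw := hY.map_eq_gaussianReal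
  rw [hmean] at hlaw
  have hmgf := mgf_gaussianReal hlaw (x / 2)
  have hint : Integrable (fun ν : EuclideanSpace ℝ κ => Real.exp (x / 2 * ∑ i, c i * ν i)) γ := by
    -- A non-integrable exponential would have moment generating function `0` by convention, against
    -- the explicit positive value.
    by_contra h
    rw [mgf, integral_undef h] at hmgf
    exact absurd hmgf (Real.exp_pos _).ne
  have hch := measure_ge_le_exp_mul_mgf (μ := γ) (X := fun ν => ∑ i, c i * ν i) (S.card * x)
    (by positivity) hint
  have hle : γ.real {ν | S.card * x ≤ ∑ i, c i * ν i} ≤ Real.exp (-x ^ 2 / 4) ^ S.card := by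
    refine hch.trans ?_
    rw [hmgf, ← Real.exp_add, ← Real.exp_nat_mul]
    refine Real.exp_le_exp.2 ?_
    rw [Real.coe_toNNReal _ (variance_nonneg _ _)]
    nlinarith [mul_le_mul_of_nonneg_right hvar (sq_nonneg x)]
  calc γ {ν | ∀ i ∈ S, ν i ≤ -x} ≤ γ {ν | S.card * x ≤ ∑ i, c i * ν i} := by
        refine measure_mono fun ν hν => ?_
        simp only [hc, Set.mem_ofPred_eq, ite_mul, zero_mul, Finset.sum_ite_mem, Finset.univ_inter]
        rw [← nsmul_eq_mul, ← Finset.sum_const]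
        refine Finset.sum_le_sum fun i hi => ?_
        linarith [hν i hi]
    _ = ENNReal.ofReal (γ.real {ν | S.card * x ≤ ∑ i, c i * ν i}) := by
        rw [ofReal_measureReal]
    _ ≤ _ := by
        rw [← ENNReal.ofReal_pow (Real.exp_pos _).le]
        exact ENNReal.ofReal_le_ofReal hle

/-- If the correlations between distinct blocks are small, then the blocks are almost independent
from the point of view of lower orthant events. -/
lemma measure_blocks_le (hZ : IsGaussianProcess Z μ) (h0 : ∀ t, ∫ ω, Z t ω ∂μ = 0)
    (h1 : ∀ t, Var[Z t; μ] = 1) (hB : B.PosSemidef) (hBd : ∀ i, B i i = 1)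
    (hB0 : ∀ i j, 0 ≤ B i j) (hB2 : ∀ i, ∑ j, B i j ≤ 2) {ε : ℝ} (hε0 : 0 ≤ ε) (hε1 : ε < 1)
    (hcov : ∀ i j, i ≠ j → ∀ s ∈ F i, ∀ t ∈ F j, cov[Z s, Z t; μ] ≤ ε * B i j)
    {x z : ℝ} (hx : 0 ≤ x) (hz : √ε * x ≤ √(1 - ε) * z) {p : ℝ≥0∞}
    (hp : ∀ i, μ {ω | ∀ t ∈ F i, Z t ω ≤ z} ≤ p) :
    μ {ω | ∀ i, ∀ t ∈ F i, Z t ω ≤ 0} ≤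
      (ENNReal.ofReal (Real.exp (-x ^ 2 / 4)) + p) ^ Fintype.card κ := by
  have := hZ.isProbabilityMeasure
  have hε1' : 0 < √(1 - ε) := Real.sqrt_pos.2 (by linarith)
  have hX : HasGaussianLaw (fun ω (p : Σ i, F i) => Z p.2 ω) μ := hasGaussianLaw_comp hZ _
  have hV := hasGaussianLaw_blockProcess (F := F) (B := B) hZ √(1 - ε) √ε
  have hcV := covariance_blockProcess (F := F) hZ hB √(1 - ε) √ε
  rw [Real.sq_sqrt hε0, Real.sq_sqrt (by linarith : 0 ≤ 1 - ε)] at hcV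
  have hle1 : ∀ s t, cov[Z s, Z t; μ] ≤ 1 := by
    intro s t
    have h := variance_nonneg (fun ω => Z s ω - Z t ω) μ
    rw [variance_fun_sub (hZ.hasGaussianLaw_eval s).memLp_two
      (hZ.hasGaussianLaw_eval t).memLp_two, h1, h1] at h
    linarith
  have h := slepian hX (fun p => h0 p.2) hV (integral_blockProcess hZ h0 _ _)
    (fun p => by
      rw [← covariance_self (hV.eval p).aemeasurable, hcV, if_pos rfl,
        covariance_self (hZ.aemeasurable _), hBd, h1]
      ring)
    (fun p q => by
      rw [hcV]
      split_ifs with hpq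
      -- Within a block, `cov ≤ (1 - ε) * cov + ε` because `cov ≤ 1`.
      · have e : B p.1 q.1 = 1 := by rw [hpq]; exact hBd _
        rw [e]
        nlinarith [hle1 p.2 q.2]
      · simpa using hcov p.1 q.1 hpq _ p.2.2 _ q.2.2) (fun _ => 0)
  have hL : {ω | ∀ i, ∀ t ∈ F i, Z t ω ≤ 0} = {ω | ∀ p : Σ i, F i, Z p.2 ω ≤ 0} := by
    ext ω
    exact (forall_sigma_finset (F := F) (p := fun _ t => Z t ω ≤ 0)).symm
  rw [hL]
  refine h.trans ?_
  -- `S` is the set of blocks where `ν` is at most `-x`; off `S` the relation between `x` and `z`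
  -- forces the copy below `z`. Summing over all `S` gives a binomial expansion.
  set R : Finset κ → Set ((κ → Ω) × EuclideanSpace ℝ κ) := fun S =>
    (Set.univ.pi fun i => if i ∈ S then Set.univ else {ω | ∀ t ∈ F i, Z t ω ≤ z}) ×ˢ
      {ν | ∀ i ∈ S, ν i ≤ -x} with hR
  have hsub : {ω | ∀ p, blockProcess Z F √(1 - ε) √ε p ω ≤ 0} ⊆
      ⋃ S ∈ (Finset.univ : Finset κ).powerset, R S := by
    intro ω hω
    simp only [Set.mem_iUnion]
    refine ⟨Finset.univ.filter fun i => ω.2 i ≤ -x, by simp, ?_, ?_⟩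
    · intro i _
      by_cases hi : ω.2 i ≤ -x
      · simp [hi]
      · simp only [Finset.mem_filter, Finset.mem_univ, true_and, hi, if_false]
        intro t ht
        have h2 := hω ⟨i, t, ht⟩
        simp only [blockProcess] at h2
        have h3 : √ε * (-x) ≤ √ε * ω.2 i :=
          mul_le_mul_of_nonneg_left (not_le.1 hi).le (Real.sqrt_nonneg _)
        exact le_of_mul_le_mul_left (by linarith) hε1'
    · intro i hi
      simpa using hi
  refine (measure_mono hsub).trans ((measure_biUnion_finset_le _ _).trans ?_)
  rw [← Finset.card_univ, ← Finset.sum_pow_mul_eq_add_pow]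
  refine Finset.sum_le_sum fun S _ => ?_
  rw [hR, blockMeasure, Measure.prod_prod, Measure.pi_pi, mul_comm]
  refine mul_le_mul' (measure_forall_le_neg_le hB hB0 hB2 S hx) ?_
  calc ∏ i, μ (if i ∈ S then Set.univ else {ω | ∀ t ∈ F i, Z t ω ≤ z})
      ≤ ∏ i, if i ∈ S then 1 else p := by
        refine Finset.prod_le_prod' fun i _ => ?_
        split_ifs
        · simp
        · exact hp i
    _ = _ := by
        rw [Finset.prod_ite]
        simp [Finset.filter_not, Finset.card_sdiff]

end Blocks

/-! ### Window suprema, finite sets of times and persistence probabilities -/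

section Windows

variable {Ω : Type*} [MeasurableSpace Ω] {μ : Measure Ω} {Z : ℝ≥0 → Ω → ℝ}

/-- Separability speaks of open sets of times, so it is applied to the interior and the two
endpoints are added to the countable set. -/
lemma IsSeparableProcess.exists_countable_subset_Icc (h : IsSeparableProcess Z μ) (s M : ℝ≥0) :
    ∃ E : Set ℝ≥0, E.Countable ∧ E.Nonempty ∧ E ⊆ Set.Icc s (s + M) ∧
      ∀ᵐ ω ∂μ, ∀ c : ℝ, (∀ t ∈ E, Z t ω ≤ c) → ∀ t ∈ Set.Icc s (s + M), Z t ω ≤ c := by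
  obtain ⟨D, hD, hω⟩ := h
  refine ⟨(Set.Ioo s (s + M) ∩ D) ∪ {s, s + M},
    (hD.mono Set.inter_subset_right).union (by simp), ⟨s, by simp⟩, ?_, ?_⟩
  · rintro t (⟨ht, -⟩ | rfl | rfl)
    · exact Set.Ioo_subset_Icc_self ht
    · simp
    · simp
  · filter_upwards [hω] with ω hω c hc t ht
    rcases eq_or_lt_of_le ht.1 with h1 | h1
    · exact hc t (by simp [h1])
    rcases eq_or_lt_of_le ht.2 with h2 | h2
    · exact hc t (by simp [h2])
    exact hω _ isOpen_Ioo (Set.Iic c) isClosed_Iic (fun t ht => hc t (Or.inl ht)) t ⟨h1, h2⟩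

/-- The probability of staying below a level on a compact window is determined by finite
sets of times. -/
lemma le_measure_window (hsep : IsSeparableProcess Z μ) (hZ : IsGaussianProcess Z μ)
    {s M : ℝ≥0} {c : ℝ} {r : ℝ≥0∞}
    (h : ∀ F : Finset ℝ≥0, (F : Set ℝ≥0) ⊆ Set.Icc s (s + M) → r ≤ μ {ω | ∀ t ∈ F, Z t ω ≤ c}) :
    r ≤ μ {ω | ∀ t ∈ Set.Icc s (s + M), Z t ω ≤ c} := by
  classical
  have := hZ.isProbabilityMeasure
  obtain ⟨E, hE, hne, hsub, hω⟩ := hsep.exists_countable_subset_Icc s M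
  obtain ⟨e, rfl⟩ := hE.exists_eq_range hne
  set A : ℕ → Set Ω := fun n => {ω | ∀ t ∈ (Finset.range n).image e, Z t ω ≤ c} with hA
  have hmeas : ∀ n, NullMeasurableSet (A n) μ := by
    intro n
    have : A n = {ω | ∀ t : (Finset.range n).image e, Z t ω ≤ c} := by
      ext ω
      exact ⟨fun h t => h t t.2, fun h t ht => h ⟨t, ht⟩⟩
    rw [this]
    exact nullMeasurableSet_forall_le (X := fun t : (Finset.range n).image e => Z t) (fun t => hZ.aemeasurable t) _
  have hanti : Antitone A := fun m n hmn ω hω t ht =>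
    hω t (Finset.image_subset_image (f := e) (Finset.range_mono hmn) ht)
  have hlim := tendsto_measure_iInter_atTop hmeas hanti ⟨0, measure_ne_top _ _⟩
  have hr : r ≤ μ (⋂ n, A n) := by
    refine ge_of_tendsto' hlim fun n => h _ ?_
    intro t ht
    simp only [Finset.coe_image, Set.mem_image] at ht
    obtain ⟨k, -, rfl⟩ := ht
    exact hsub ⟨k, rfl⟩
  refine hr.trans (measure_mono_ae ?_)
  filter_upwards [hω] with ω hω hm
  refine hω c ?_
  rintro _ ⟨k, rfl⟩
  exact Set.mem_iInter.1 hm (k + 1) _ (Finset.mem_image_of_mem _ (by simp))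

omit [MeasurableSpace Ω] in
lemma windowSup_le_iff {s M : ℝ≥0} {c : ℝ} {ω : Ω} :
    windowSup Z s M ω ≤ (c : EReal) ↔ ∀ t ∈ Set.Icc s (s + M), Z t ω ≤ c := by
  simp only [windowSup, iSup_le_iff, EReal.coe_le_coe_iff]
  constructor
  · intro h t ht
    have := h (t - s) ⟨zero_le, tsub_le_iff_left.2 ht.2⟩
    rwa [add_tsub_cancel_of_le ht.1] at this
  · intro h t ht
    exact h _ ⟨le_self_add, by gcongr; exact ht.2⟩

-- Slepian and separability handle closed conditions at a fixed level, so the strict event is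
-- exhausted by levels `-1 / (n + 1)`.
omit [MeasurableSpace Ω] in
lemma setOf_windowSup_lt_zero (s M : ℝ≥0) :
    {ω | windowSup Z s M ω < 0} =
      ⋃ n : ℕ, {ω | ∀ t ∈ Set.Icc s (s + M), Z t ω ≤ -(1 / ((n : ℝ) + 1))} := by
  ext ω
  simp only [Set.mem_iUnion, Set.mem_ofPred_eq, ← windowSup_le_iff]
  constructor
  · intro h
    obtain ⟨q, hq1, hq2⟩ := EReal.lt_iff_exists_real_btwn.1 h
    obtain ⟨n, hn⟩ := exists_nat_one_div_lt (neg_pos.2 (EReal.coe_neg'.1 hq2))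
    exact ⟨n, hq1.le.trans (EReal.coe_le_coe_iff.2 (by linarith))⟩
  · rintro ⟨n, hn⟩
    exact hn.trans_lt (EReal.coe_neg'.2 (neg_neg_of_pos (by positivity)))

/-- The probability of being negative on the window `[s, s + M]`. -/
def persistProb (Z : ℝ≥0 → Ω → ℝ) (μ : Measure Ω) (s M : ℝ≥0) : ℝ≥0∞ :=
  μ {ω | windowSup Z s M ω < 0}

omit [MeasurableSpace Ω] in
lemma monotone_window_neg (s M : ℝ≥0) : Monotone fun n : ℕ =>
    {ω | ∀ t ∈ Set.Icc s (s + M), Z t ω ≤ -(1 / ((n : ℝ) + 1))} := by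
  intro m n hmn ω hω t ht
  refine (hω t ht).trans (neg_le_neg ?_)
  gcongr

lemma persistProb_eq_iSup (s M : ℝ≥0) : persistProb Z μ s M =
    ⨆ n : ℕ, μ {ω | ∀ t ∈ Set.Icc s (s + M), Z t ω ≤ -(1 / ((n : ℝ) + 1))} := by
  rw [persistProb, setOf_windowSup_lt_zero, (monotone_window_neg s M).measure_iUnion]

lemma measure_window_le_persistProb {s M : ℝ≥0} {c : ℝ} (hc : c < 0) :
    μ {ω | ∀ t ∈ Set.Icc s (s + M), Z t ω ≤ c} ≤ persistProb Z μ s M := by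
  refine measure_mono fun ω hω => ?_
  exact (windowSup_le_iff.2 hω).trans_lt (EReal.coe_neg'.2 hc)

lemma persistProb_anti (s : ℝ≥0) {M M' : ℝ≥0} (h : M ≤ M') :
    persistProb Z μ s M' ≤ persistProb Z μ s M := by
  refine measure_mono fun ω (hω : windowSup Z s M' ω < 0) => lt_of_le_of_lt ?_ hω
  exact biSup_mono fun t ht => ⟨ht.1, ht.2.trans h⟩

/-- Supermultiplicativity over `n` adjacent windows. The strict bound on `q` leaves room for a
negative level in each window, and finitely many windows share one such level `-1 / (m₀ + 1)`. -/
lemma pow_le_persistProb (hZ : IsCenteredGaussian Z μ) (hcov : ∀ s t, 0 ≤ cov[Z s, Z t; μ])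
    {M : ℝ≥0} {q : ℝ≥0∞} (hq : ∀ s, q < persistProb Z μ s M) {n : ℕ}
    (hn : 0 < n) : q ^ n ≤ persistProb Z μ 0 (n * M) := by
  have h1 : ∀ i : Fin n, ∃ m : ℕ, q ≤ μ {ω | ∀ t ∈ Set.Icc ((i : ℕ) * M) ((i : ℕ) * M + M),
      Z t ω ≤ -(1 / ((m : ℝ) + 1))} := by
    intro i
    have := hq ((i : ℕ) * M)
    rw [persistProb_eq_iSup, lt_iSup_iff] at this
    exact this.imp fun m h => h.le
  choose m hm using h1
  set m₀ := Finset.univ.sup m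
  refine le_trans ?_ (measure_window_le_persistProb (c := -(1 / ((m₀ : ℝ) + 1)))
    (neg_neg_of_pos (by positivity)))
  refine le_measure_window hZ.separable hZ.gaussian fun F hF => ?_
  set G : Fin n → Finset ℝ≥0 := fun i =>
    F.filter fun t => t ∈ Set.Icc ((i : ℕ) * M) ((i : ℕ) * M + M) with hG
  have h2 := prod_measure_le_measure_blocks (F := G) hZ.gaussian hZ.centered hcov
    (-(1 / ((m₀ : ℝ) + 1)))
  have h3 : q ^ n ≤ ∏ i, μ {ω | ∀ t ∈ G i, Z t ω ≤ -(1 / ((m₀ : ℝ) + 1))} := by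
    have e : q ^ n = ∏ _i : Fin n, q := by simp
    rw [e]
    refine Finset.prod_le_prod' fun i _ => (hm i).trans (measure_mono fun ω hω t ht => ?_)
    exact monotone_window_neg _ _ (Finset.le_sup (f := m) (Finset.mem_univ i)) hω t
      (Finset.mem_filter.1 ht).2
  refine h3.trans (h2.trans (measure_mono fun ω hω t ht => ?_))
  have htn := (hF ht).2
  rw [zero_add] at htn
  rcases eq_or_ne M 0 with rfl | hM
  · refine hω ⟨0, hn⟩ t (Finset.mem_filter.2 ⟨ht, ?_⟩)
    simpa using htn
  have hM' : 0 < M := pos_iff_ne_zero.2 hM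
  -- The right endpoint `n * M` would get floor index `n`, so it is assigned to the last window.
  rcases eq_or_lt_of_le htn with htn | htn
  · refine hω ⟨n - 1, by omega⟩ t (Finset.mem_filter.2 ⟨ht, ?_⟩)
    have : ((n - 1 : ℕ) : ℝ≥0) * M + M = n * M := by
      rw [← add_one_mul]
      congr 1
      exact_mod_cast Nat.sub_add_cancel hn
    exact ⟨by rw [htn, ← this]; exact le_self_add, by rw [htn, ← this]⟩
  · have hfl : ⌊t / M⌋₊ < n := (Nat.floor_lt zero_le).2 ((div_lt_iff₀ hM').2 htn)
    refine hω ⟨⌊t / M⌋₊, hfl⟩ t (Finset.mem_filter.2 ⟨ht, ?_, ?_⟩)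
    · exact (le_div_iff₀ hM').1 (Nat.floor_le zero_le)
    · rw [← add_one_mul]
      exact ((div_lt_iff₀ hM').1 (Nat.lt_floor_add_one _)).le

lemma cov_eq_autocorr_mul {v : ℝ} (hv : ∀ t, Var[Z t; μ] = v) (hv0 : 0 < v) (s t : ℝ≥0) :
    cov[Z s, Z t; μ] = autocorr Z μ s t * v := by
  rw [autocorr, hv, hv, Real.mul_self_sqrt hv0.le, div_mul_cancel₀ _ hv0.ne']

lemma autocorr_comm (s t : ℝ≥0) : autocorr Z μ s t = autocorr Z μ t s := by
  rw [autocorr, autocorr, covariance_comm, mul_comm]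

lemma IsStationaryGaussian.autocorr_eq_nndist {A : ℝ≥0 → ℝ} (h : IsStationaryGaussian Z μ A)
    (s t : ℝ≥0) : autocorr Z μ s t = A (nndist s t) := by
  rcases le_total s t with hst | hst
  · have := h.autocorr_eq s (t - s)
    rw [add_tsub_cancel_of_le hst] at this
    rw [this, NNReal.nndist_eq, max_eq_right]
    simp [tsub_eq_zero_of_le hst]
  · have := h.autocorr_eq t (s - t)
    rw [add_tsub_cancel_of_le hst] at this
    rw [autocorr_comm, this, NNReal.nndist_eq, max_eq_left]
    simp [tsub_eq_zero_of_le hst]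

/-- Comparison of the persistence probabilities of two processes with the same correlations. -/
lemma persistProb_le_of_autocorr_eq {Ω' : Type*} [MeasurableSpace Ω'] {μ' : Measure Ω'}
    {Z' : ℝ≥0 → Ω' → ℝ} (hZ : IsCenteredGaussian Z μ) (hZ' : IsCenteredGaussian Z' μ')
    {v v' : ℝ} (hv : ∀ t, Var[Z t; μ] = v) (hv0 : 0 < v) (hv' : ∀ t, Var[Z' t; μ'] = v')
    (hv0' : 0 < v') {s s' : ℝ≥0}
    (h : ∀ t t', autocorr Z μ (s + t) (s + t') = autocorr Z' μ' (s' + t) (s' + t')) (M : ℝ≥0) :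
    persistProb Z μ s M ≤ persistProb Z' μ' s' M := by
  rw [persistProb_eq_iSup]
  refine iSup_le fun m => ?_
  set δ : ℝ := 1 / ((m : ℝ) + 1)
  have hδ : 0 < δ := by positivity
  -- Rescaling equalizes the variances; the level stays negative, which is all that persistence
  -- requires.
  set a : ℝ := √v' / √v with ha
  have ha0 : 0 < a := div_pos (Real.sqrt_pos.2 hv0') (Real.sqrt_pos.2 hv0)
  have ha2 : a ^ 2 * v = v' := by
    rw [ha, div_pow, Real.sq_sqrt hv0.le, Real.sq_sqrt hv0'.le, div_mul_cancel₀ _ hv0.ne']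
  refine le_trans ?_ (measure_window_le_persistProb (c := a * -δ)
    (mul_neg_of_pos_of_neg ha0 (neg_neg_of_pos hδ)))
  refine le_measure_window hZ'.separable hZ'.gaussian fun F hF => ?_
  have hX : HasGaussianLaw (fun ω (t : F) => a * Z (s + (t - s')) ω) μ :=
    (hasGaussianLaw_comp hZ.gaussian fun t : F => s + ((t : ℝ≥0) - s')).smul a
  have hY : HasGaussianLaw (fun ω (t : F) => Z' t ω) μ' := hasGaussianLaw_comp hZ'.gaussian _
  have hS := slepian (X := fun (t : F) ω => a * Z (s + (t - s')) ω) hX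
    (fun t => by rw [integral_const_mul, hZ.centered, mul_zero]) hY (fun t => hZ'.centered _)
    (fun t => by rw [variance_const_mul, hv, hv', ha2])
    (fun t t' => by
      rw [covariance_const_mul_left, covariance_const_mul_right, cov_eq_autocorr_mul hv hv0,
        cov_eq_autocorr_mul hv' hv0', h, add_tsub_cancel_of_le (hF t.2).1,
        add_tsub_cancel_of_le (hF t'.2).1, ← ha2]
      exact le_of_eq (by ring)) (fun _ => a * -δ)
  refine le_trans (measure_mono ?_) (hS.trans (measure_mono fun ω hω t ht => ?_))
  · intro ω hω t
    refine mul_le_mul_of_nonneg_left (hω _ ⟨le_self_add, ?_⟩) ha0.le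
    have := (hF t.2).2
    gcongr
    exact tsub_le_iff_left.2 this
  · exact hω ⟨t, ht⟩

end Windows

/-! ### Exponential form of rate inequalities -/

section Rates

lemma log_ofReal_exp (x : ℝ) : ENNReal.log (ENNReal.ofReal (Real.exp x)) = (x : EReal) := by
  rw [ENNReal.log_ofReal, if_neg (not_le.2 (Real.exp_pos x)), Real.log_exp]

lemma log_div_le_iff {L : ℝ} (hL : 0 < L) {p : ℝ≥0∞} {c : ℝ} :
    ENNReal.log p / (L : EReal) ≤ (c : EReal) ↔ p ≤ ENNReal.ofReal (Real.exp (c * L)) := by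
  rw [EReal.div_le_iff_le_mul (EReal.coe_pos.2 hL) (EReal.coe_ne_top L), ← ENNReal.log_le_log_iff,
    log_ofReal_exp, mul_comm, EReal.coe_mul]

lemma le_log_div_iff {L : ℝ} (hL : 0 < L) {p : ℝ≥0∞} {c : ℝ} :
    (c : EReal) ≤ ENNReal.log p / (L : EReal) ↔ ENNReal.ofReal (Real.exp (c * L)) ≤ p := by
  rw [EReal.le_div_iff_mul_le (EReal.coe_pos.2 hL) (EReal.coe_ne_top L), ← ENNReal.log_le_log_iff,
    log_ofReal_exp, EReal.coe_mul]

lemma logRate_le_iff {T : ℝ≥0} (hT : 0 < T) {p : ℝ≥0∞} {c : ℝ} :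
    logRate T p ≤ (c : EReal) ↔ p ≤ ENNReal.ofReal (Real.exp (c * T)) :=
  log_div_le_iff (NNReal.coe_pos.2 hT)

lemma le_logRate_iff {T : ℝ≥0} (hT : 0 < T) {p : ℝ≥0∞} {c : ℝ} :
    (c : EReal) ≤ logRate T p ↔ ENNReal.ofReal (Real.exp (c * T)) ≤ p :=
  le_log_div_iff (NNReal.coe_pos.2 hT)

lemma lt_logRate_iff {T : ℝ≥0} (hT : 0 < T) {p : ℝ≥0∞} {c : ℝ} :
    (c : EReal) < logRate T p ↔ ENNReal.ofReal (Real.exp (c * T)) < p := by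
  rw [← not_le, logRate_le_iff hT, not_le]

lemma logRate_lt_iff {T : ℝ≥0} (hT : 0 < T) {p : ℝ≥0∞} {c : ℝ} :
    logRate T p < (c : EReal) ↔ p < ENNReal.ofReal (Real.exp (c * T)) := by
  rw [← not_le, le_logRate_iff hT, not_le]

lemma logRate_nonpos {T : ℝ≥0} (hT : 0 < T) {p : ℝ≥0∞} (hp : p ≤ 1) : logRate T p ≤ 0 := by
  rw [← EReal.coe_zero, logRate_le_iff hT]
  simpa using hp

lemma eventually_mul_le_mul_add {a b : ℝ} (h : a < b) (c : ℝ) :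
    ∀ᶠ T : ℝ≥0 in atTop, a * T ≤ b * T + c := by
  have h1 : Tendsto (fun T : ℝ≥0 => (b - a) * (T : ℝ)) atTop atTop :=
    (NNReal.tendsto_coe_atTop.2 tendsto_id).const_mul_atTop (sub_pos.2 h)
  filter_upwards [h1.eventually_ge_atTop (-c)] with T hT
  linarith

end Rates

/-! ### Lower bounds and existence of the exponent -/

section Lower

variable {Ω : Type*} [MeasurableSpace Ω] {μ : Measure Ω} {Z : ℝ≥0 → Ω → ℝ}

/-- Covering `[0, T]` by `⌈T / M⌉₊` windows overshoots by at most `M`; as `c ≤ 0`, this costs at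
most the factor `exp (c * M)`, absorbed by `a < c` for large `T`. -/
lemma le_logRate_persistProb (hZ : IsCenteredGaussian Z μ) (hcov : ∀ s t, 0 ≤ cov[Z s, Z t; μ])
    {M : ℝ≥0} (hM : 0 < M) {a c : ℝ} (hc : c ≤ 0)
    (hq : ∀ s, ENNReal.ofReal (Real.exp (c * M)) < persistProb Z μ s M) {T : ℝ≥0} (hT : 0 < T)
    (hT' : a * T ≤ c * T + c * M) : (a : EReal) ≤ logRate T (persistProb Z μ 0 T) := by
  rw [le_logRate_iff hT]
  set n := ⌈T / M⌉₊
  have hn : 0 < n := Nat.ceil_pos.2 (div_pos hT hM)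
  have h1 : T ≤ n * M := (div_le_iff₀ hM).1 (Nat.le_ceil _)
  have h2 : (n : ℝ≥0) * M ≤ T + M := by
    have := (Nat.ceil_lt_add_one (zero_le : 0 ≤ T / M)).le
    calc (n : ℝ≥0) * M ≤ (T / M + 1) * M := by gcongr
      _ = T + M := by rw [add_mul, div_mul_cancel₀ _ hM.ne', one_mul]
  refine le_trans ?_ ((pow_le_persistProb hZ hcov hq hn).trans (persistProb_anti 0 h1))
  rw [← ENNReal.ofReal_pow (Real.exp_pos _).le, ← Real.exp_nat_mul]
  refine ENNReal.ofReal_le_ofReal (Real.exp_le_exp.2 (hT'.trans ?_))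
  have h3 : (n : ℝ) * M ≤ T + M := by exact_mod_cast h2
  nlinarith

/-- The persistence exponent exists when persistence probabilities are translation invariant. -/
lemma tendsto_logRate_persistProb (hZ : IsCenteredGaussian Z μ)
    (hcov : ∀ s t, 0 ≤ cov[Z s, Z t; μ])
    (hst : ∀ s M, persistProb Z μ s M = persistProb Z μ 0 M) :
    Tendsto (fun T : ℝ≥0 => logRate T (persistProb Z μ 0 T)) atTop
      (𝓝 (⨆ M ∈ Set.Ioi (0 : ℝ≥0), logRate M (persistProb Z μ 0 M))) := by
  have := hZ.gaussian.isProbabilityMeasure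
  refine tendsto_order.2 ⟨fun a ha => ?_, fun a ha => ?_⟩
  · obtain ⟨M, hM⟩ := lt_iSup_iff.1 ha
    obtain ⟨hM0, hM⟩ := lt_iSup_iff.1 hM
    have hM0 : 0 < M := hM0
    obtain ⟨c, hac, hcM⟩ := EReal.lt_iff_exists_real_btwn.1 hM
    obtain ⟨d, had, hdc⟩ := EReal.lt_iff_exists_real_btwn.1 hac
    have hc : c ≤ 0 := EReal.coe_nonpos.1 (hcM.le.trans (logRate_nonpos hM0 prob_le_one))
    filter_upwards [eventually_mul_le_mul_add (EReal.coe_lt_coe_iff.1 hdc) (c * M),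
      eventually_gt_atTop 0] with T hT hT0
    refine had.trans_le (le_logRate_persistProb hZ hcov hM0 hc (fun s => ?_) hT0 hT)
    rw [hst]
    exact (lt_logRate_iff hM0).1 hcM
  · filter_upwards [eventually_gt_atTop 0] with T hT0
    exact (le_iSup₂ (f := fun (M : ℝ≥0) (_ : M ∈ Set.Ioi (0 : ℝ≥0)) =>
      logRate M (persistProb Z μ 0 M)) T hT0).trans_lt ha

lemma IsStationaryGaussian.persistProb_eq {A : ℝ≥0 → ℝ} (h : IsStationaryGaussian Z μ A)
    {Ω' : Type*} [MeasurableSpace Ω'] {μ' : Measure Ω'} {Z' : ℝ≥0 → Ω' → ℝ}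
    (h' : IsStationaryGaussian Z' μ' A) (s s' M : ℝ≥0) :
    persistProb Z μ s M = persistProb Z' μ' s' M := by
  have key : ∀ t t' : ℝ≥0, autocorr Z μ (s + t) (s + t') = autocorr Z' μ' (s' + t) (s' + t') := by
    intro t t'
    rw [h.autocorr_eq_nndist, h'.autocorr_eq_nndist]
    congr 1
    ext
    simp [NNReal.dist_eq]
  exact le_antisymm
    (persistProb_le_of_autocorr_eq h.centeredGaussian h'.centeredGaussian h.variance_const
      h.variance_pos h'.variance_const h'.variance_pos key M)
    (persistProb_le_of_autocorr_eq h'.centeredGaussian h.centeredGaussian h'.variance_const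
      h'.variance_pos h.variance_const h.variance_pos (fun t t' => (key t t').symm) M)

end Lower

/-- A reference process, if there is one, defines the exponent, and all others with the same `A`
have the same persistence probabilities. Otherwise the claim is vacuous and `0` serves. -/
lemma exists_persistence_exponent {A : ℝ≥0 → ℝ} (hA : A ∈ StationaryAutocorrPlus) :
    ∃ b : EReal, 0 ≤ b ∧ ∀ (Ω : Type u) [MeasurableSpace Ω] (μ : Measure Ω)
      [IsProbabilityMeasure μ] (Z : ℝ≥0 → Ω → ℝ), IsStationaryGaussian Z μ A →
      Tendsto (fun T : ℝ≥0 => -logRate T (μ {ω | windowSup Z 0 T ω < 0})) atTop (𝓝 b) := by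
  by_cases hex : ∃ (Ω : Type u) (_ : MeasurableSpace Ω) (μ : Measure Ω) (Z : ℝ≥0 → Ω → ℝ),
      IsStationaryGaussian Z μ A
  · obtain ⟨Ω₀, _, μ₀, Z₀, h₀⟩ := hex
    have := h₀.centeredGaussian.gaussian.isProbabilityMeasure
    refine ⟨-⨆ M ∈ Set.Ioi (0 : ℝ≥0), logRate M (persistProb Z₀ μ₀ 0 M), ?_, ?_⟩
    · rw [EReal.le_neg, neg_zero]
      exact iSup₂_le fun M hM => logRate_nonpos hM prob_le_one
    · intro Ω _ μ _ Z h
      have hl := tendsto_logRate_persistProb h₀.centeredGaussian (fun s t => by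
          rw [cov_eq_autocorr_mul h₀.variance_const h₀.variance_pos, h₀.autocorr_eq_nndist]
          exact mul_nonneg (hA.2 _) h₀.variance_pos.le) (fun s M => h₀.persistProb_eq h₀ s 0 M)
      refine (continuous_neg.tendsto _).comp (hl.congr fun T => ?_)
      rw [h₀.persistProb_eq h 0 0 T]
      rfl
  · exact ⟨0, le_rfl, fun Ω _ μ _ Z h => (hex ⟨Ω, _, μ, Z, h⟩).elim⟩

/-! ### A positive semidefinite matrix with polynomial decay -/

section Toeplitz

/-- Diagonal dominance: expand `∑ β i j (x i + x j)² ≥ 0` and bound the square terms by the row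
sums. -/
lemma posSemidef_one_add {κ : Type*} [Fintype κ] [DecidableEq κ] {β : Matrix κ κ ℝ}
    (hs : ∀ i j, β i j = β j i) (h0 : ∀ i j, 0 ≤ β i j) (h1 : ∀ i, ∑ j, β i j ≤ 1) :
    (1 + β).PosSemidef := by
  refine Matrix.PosSemidef.of_dotProduct_mulVec_nonneg ?_ fun x => ?_
  · ext i j
    simp [Matrix.one_apply, eq_comm, hs i j]
  · have e : star x ⬝ᵥ (1 + β).mulVec x = ∑ i, x i ^ 2 + ∑ i, ∑ j, β i j * (x i * x j) := by
      rw [Matrix.add_mulVec, Matrix.one_mulVec, dotProduct_add]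
      simp only [dotProduct, Matrix.mulVec, Finset.mul_sum, star_trivial]
      congr 1
      · exact Finset.sum_congr rfl fun i _ => by ring
      · exact Finset.sum_congr rfl fun i _ => Finset.sum_congr rfl fun j _ => by ring
    have h2 : ∑ i, ∑ j, β i j * x i ^ 2 ≤ ∑ i, x i ^ 2 := by
      refine Finset.sum_le_sum fun i _ => ?_
      rw [← Finset.sum_mul]
      exact mul_le_of_le_one_left (sq_nonneg _) (h1 i)
    have h3 : ∑ i, ∑ j, β i j * x j ^ 2 = ∑ i, ∑ j, β i j * x i ^ 2 := by
      rw [Finset.sum_comm]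
      simp only [hs]
    have h4 : 0 ≤ ∑ i, ∑ j, β i j * (x i + x j) ^ 2 :=
      Finset.sum_nonneg fun i _ => Finset.sum_nonneg fun j _ => mul_nonneg (h0 i j) (sq_nonneg _)
    have h5 : ∑ i, ∑ j, β i j * (x i + x j) ^ 2 = ∑ i, ∑ j, β i j * x i ^ 2 +
        2 * ∑ i, ∑ j, β i j * (x i * x j) + ∑ i, ∑ j, β i j * x j ^ 2 := by
      simp only [Finset.mul_sum, ← Finset.sum_add_distrib]
      exact Finset.sum_congr rfl fun i _ => Finset.sum_congr rfl fun j _ => by ring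
    rw [e]
    linarith

/-- The total mass of the two-sided power sequence `|m| ^ (-α)`. -/
def powerMass (α : ℝ) : ℝ := ∑' m : ℤ, |(m : ℝ)| ^ (-α)

lemma powerMass_pos {α : ℝ} (hα : 1 < α) : 0 < powerMass α :=
  (Real.summable_abs_int_rpow hα).tsum_pos (fun _ => by positivity) 1 (by simp)

/-- A normalized Toeplitz matrix with polynomially decaying off-diagonal entries. -/
def powerMatrix (n : ℕ) (α : ℝ) : Matrix (Fin n) (Fin n) ℝ :=
  Matrix.of fun i j => |((i : ℕ) : ℝ) - (j : ℕ)| ^ (-α) / powerMass α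

lemma powerMatrix_nonneg {n : ℕ} {α : ℝ} (hα : 1 < α) (i j : Fin n) : 0 ≤ powerMatrix n α i j :=
  div_nonneg (by positivity) (powerMass_pos hα).le

/-- The convention `0 ^ (-α) = 0` makes the diagonal vanish, so that `1 + powerMatrix n α` has unit
diagonal. -/
lemma powerMatrix_self {n : ℕ} {α : ℝ} (hα : 1 < α) (i : Fin n) : powerMatrix n α i i = 0 := by
  simp [powerMatrix, Real.zero_rpow (show -α ≠ 0 by linarith)]

lemma sum_powerMatrix_le {n : ℕ} {α : ℝ} (hα : 1 < α) (i : Fin n) :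
    ∑ j, powerMatrix n α i j ≤ 1 := by
  simp only [powerMatrix, Matrix.of_apply]
  rw [← Finset.sum_div, div_le_one (powerMass_pos hα)]
  have hinj : Function.Injective fun j : Fin n => ((i : ℕ) : ℤ) - ((j : ℕ) : ℤ) := fun j k h =>
    Fin.ext (by simpa using h)
  have h := (Real.summable_abs_int_rpow hα).sum_le_tsum
    (Finset.univ.map ⟨_, hinj⟩) (fun _ _ => by positivity)
  rw [Finset.sum_map] at h
  simpa [powerMass] using h

lemma posSemidef_one_add_powerMatrix (n : ℕ) {α : ℝ} (hα : 1 < α) :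
    (1 + powerMatrix n α).PosSemidef :=
  posSemidef_one_add (fun i j => by simp [powerMatrix, abs_sub_comm])
    (powerMatrix_nonneg hα) (sum_powerMatrix_le hα)

end Toeplitz

/-! ### Upper bounds from separated windows -/

section Upper

variable {Ω : Type*} [MeasurableSpace Ω] {μ : Measure Ω} {Z : ℝ≥0 → Ω → ℝ}

/-- Times in windows `i < j` are at least `(j - i) * L` apart, so the decay factors into `L ^ (-α)`
and a Toeplitz entry. -/
lemma cov_le_powerMatrix {α : ℝ} (hα : 1 < α) (h1 : ∀ t, Var[Z t; μ] = 1) {τ₀ M L : ℝ≥0}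
    (hdecay : ∀ s τ, τ₀ ≤ τ → autocorr Z μ s (s + τ) ≤ (τ : ℝ) ^ (-α)) (hL : 0 < L)
    (hτ : τ₀ ≤ L) {n : ℕ} {i j : Fin n} (hij : i < j) {s t : ℝ≥0}
    (hs : s ∈ Set.Icc ((i : ℕ) * (M + L)) ((i : ℕ) * (M + L) + M))
    (ht : t ∈ Set.Icc ((j : ℕ) * (M + L)) ((j : ℕ) * (M + L) + M)) :
    cov[Z s, Z t; μ] ≤ powerMass α * (L : ℝ) ^ (-α) * powerMatrix n α i j := by
  have hij' : ((i : ℕ) : ℝ) + 1 ≤ (j : ℕ) := by exact_mod_cast hij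
  have hs2 : (s : ℝ) ≤ (i : ℕ) * (M + L) + M := by exact_mod_cast hs.2
  have ht1 : ((j : ℕ) : ℝ) * (M + L) ≤ t := by exact_mod_cast ht.1
  have hM0 : (0 : ℝ) ≤ M := M.2
  have hL0 : (0 : ℝ) < L := hL
  have hgap : (((j : ℕ) : ℝ) - (i : ℕ)) * L ≤ (t : ℝ) - s := by nlinarith
  have hgap0 : 0 < (((j : ℕ) : ℝ) - (i : ℕ)) * L := mul_pos (by linarith) hL0
  have hst : s ≤ t := by
    rw [← NNReal.coe_le_coe]
    linarith
  have hd := hdecay s (t - s) (by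
    rw [← NNReal.coe_le_coe, NNReal.coe_sub hst]
    have : (τ₀ : ℝ) ≤ L := by exact_mod_cast hτ
    nlinarith)
  rw [add_tsub_cancel_of_le hst, NNReal.coe_sub hst] at hd
  rw [cov_eq_autocorr_mul h1 one_pos, mul_one]
  refine hd.trans ((Real.rpow_le_rpow_of_nonpos hgap0 hgap (by linarith)).trans (le_of_eq ?_))
  rw [Real.mul_rpow (by linarith) hL0.le, powerMatrix, Matrix.of_apply, abs_sub_comm,
    abs_of_nonneg (by linarith : (0 : ℝ) ≤ ((j : ℕ) : ℝ) - (i : ℕ))]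
  field_simp [(powerMass_pos hα).ne']

/-- The upper bound obtained by cutting `[0, T]` into windows of length `M` separated by gaps of
length `L`. -/
lemma persistProb_le_pow (hZ : IsCenteredGaussian Z μ) (h1 : ∀ t, Var[Z t; μ] = 1) {α : ℝ}
    (hα : 1 < α) {τ₀ M L : ℝ≥0}
    (hdecay : ∀ s τ, τ₀ ≤ τ → autocorr Z μ s (s + τ) ≤ (τ : ℝ) ^ (-α)) (hL : 0 < L)
    (hτ : τ₀ ≤ L) (hε : powerMass α * (L : ℝ) ^ (-α) < 1) {x z : ℝ} (hx : 0 ≤ x)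
    (hz : √(powerMass α * (L : ℝ) ^ (-α)) * x ≤ √(1 - powerMass α * (L : ℝ) ^ (-α)) * z)
    {p : ℝ≥0∞} (hp : ∀ s, μ {ω | windowSup Z s M ω ≤ z} < p) {n : ℕ} {T : ℝ≥0}
    (hT : n * (M + L) ≤ T) :
    persistProb Z μ 0 T ≤ (ENNReal.ofReal (Real.exp (-x ^ 2 / 4)) + p) ^ n := by
  -- Slepian needs finite blocks: as `p` strictly exceeds the window probability, some finite set of
  -- times already does no worse than `p`.
  have h2 : ∀ i : Fin n, ∃ F : Finset ℝ≥0,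
      (F : Set ℝ≥0) ⊆ Set.Icc ((i : ℕ) * (M + L)) ((i : ℕ) * (M + L) + M) ∧
        μ {ω | ∀ t ∈ F, Z t ω ≤ z} < p := by
    intro i
    by_contra! h
    refine absurd (le_measure_window hZ.separable hZ.gaussian h) (not_le.2 ?_)
    simpa only [windowSup_le_iff] using hp ((i : ℕ) * (M + L))
  choose F hF hFp using h2
  have hB : ∀ i j : Fin n, i ≠ j → (1 + powerMatrix n α) i j = powerMatrix n α i j := by
    intro i j hij
    simp [Matrix.one_apply_ne hij]
  have hsymm : ∀ i j : Fin n, powerMatrix n α i j = powerMatrix n α j i := fun i j => by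
    simp [powerMatrix, abs_sub_comm]
  have h := measure_blocks_le (F := F) hZ.gaussian hZ.centered h1
    (posSemidef_one_add_powerMatrix n hα)
    (fun i => by simp [powerMatrix_self hα])
    (fun i j => add_nonneg (by rw [Matrix.one_apply]; split_ifs <;> simp)
      (powerMatrix_nonneg hα i j))
    (fun i => by
      have := sum_powerMatrix_le hα i
      simp only [Matrix.add_apply, Finset.sum_add_distrib, Matrix.one_apply, Finset.sum_ite_eq,
        Finset.mem_univ, if_true]
      linarith)
    (mul_nonneg (powerMass_pos hα).le (by positivity)) hε
    (fun i j hij s hs t ht => by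
      rw [hB i j hij]
      rcases lt_or_gt_of_ne hij with h | h
      · exact cov_le_powerMatrix hα h1 hdecay hL hτ h (hF i hs) (hF j ht)
      · rw [covariance_comm, hsymm]
        exact cov_le_powerMatrix hα h1 hdecay hL hτ h (hF j ht) (hF i hs))
    hx hz (fun i => (hFp i).le)
  rw [Fintype.card_fin] at h
  refine le_trans (measure_mono ?_) h
  intro ω hω i t ht
  have hω : windowSup Z 0 T ω < ((0 : ℝ) : EReal) := hω
  refine windowSup_le_iff.1 hω.le t ⟨zero_le, ?_⟩
  rw [zero_add]
  have hi : ((i : ℕ) : ℝ≥0) + 1 ≤ n := by exact_mod_cast i.2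
  calc t ≤ (i : ℕ) * (M + L) + M := (hF i ht).2
    _ ≤ (i : ℕ) * (M + L) + (M + L) := by gcongr; exact le_self_add
    _ = ((i : ℕ) + 1) * (M + L) := by ring
    _ ≤ n * (M + L) := by gcongr
    _ ≤ T := hT

lemma logRate_persistProb_le (hZ : IsCenteredGaussian Z μ) (h1 : ∀ t, Var[Z t; μ] = 1) {α : ℝ}
    (hα : 1 < α) {τ₀ M L : ℝ≥0} (hM : 0 < M)
    (hdecay : ∀ s τ, τ₀ ≤ τ → autocorr Z μ s (s + τ) ≤ (τ : ℝ) ^ (-α)) (hL : 0 < L)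
    (hτ : τ₀ ≤ L) (hε : powerMass α * (L : ℝ) ^ (-α) < 1) {x z : ℝ} (hx : 0 ≤ x)
    (hz : √(powerMass α * (L : ℝ) ^ (-α)) * x ≤ √(1 - powerMass α * (L : ℝ) ^ (-α)) * z)
    {a₁ a₂ : ℝ} (ha₁ : 0 ≤ a₁)
    (hexp : Real.exp (-x ^ 2 / 4) + Real.exp (-a₂ * M) ≤ Real.exp (-a₁ * M))
    (hp : ∀ s, μ {ω | windowSup Z s M ω ≤ z} < ENNReal.ofReal (Real.exp (-a₂ * M)))
    {a : ℝ} {T : ℝ≥0} (hT0 : 0 < T) (hT : a * T ≤ a₁ * M / (M + L) * T + -(a₁ * M)) :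
    logRate T (persistProb Z μ 0 T) ≤ ((-a : ℝ) : EReal) := by
  rw [logRate_le_iff hT0]
  have hML : 0 < M + L := add_pos hM hL
  have hn : (⌊T / (M + L)⌋₊ : ℝ≥0) * (M + L) ≤ T :=
    (le_div_iff₀ hML).1 (Nat.floor_le zero_le)
  refine (persistProb_le_pow hZ h1 hα hdecay hL hτ hε hx hz hp hn).trans ?_
  rw [← ENNReal.ofReal_add (Real.exp_pos _).le (Real.exp_pos _).le,
    ← ENNReal.ofReal_pow (by positivity)]
  refine ENNReal.ofReal_le_ofReal ((pow_le_pow_left₀ (by positivity) hexp _).trans ?_)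
  rw [← Real.exp_nat_mul]
  refine Real.exp_le_exp.2 ?_
  have hfl : (T : ℝ) / (M + L) ≤ (⌊T / (M + L)⌋₊ : ℝ) + 1 := by
    have := (Nat.lt_floor_add_one (T / (M + L))).le
    exact_mod_cast this
  have h0 : 0 ≤ a₁ * M := mul_nonneg ha₁ M.2
  have := mul_le_mul_of_nonneg_left hfl h0
  have e : a₁ * M / (M + L) * T = a₁ * M * ((T : ℝ) / (M + L)) := by ring
  linarith

end Upper

/-! ### Choice of scales -/

section Scales

lemma tendsto_coe_rpow_atTop {r : ℝ} (hr : 0 < r) :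
    Tendsto (fun M : ℝ≥0 => (M : ℝ) ^ r) atTop atTop :=
  (tendsto_rpow_atTop hr).comp (NNReal.tendsto_coe_atTop.2 tendsto_id)

lemma tendsto_coe_rpow_neg {r : ℝ} (hr : 0 < r) :
    Tendsto (fun M : ℝ≥0 => (M : ℝ) ^ (-r)) atTop (𝓝 0) :=
  (tendsto_rpow_neg_atTop hr).comp (NNReal.tendsto_coe_atTop.2 tendsto_id)

lemma eventually_mul_rpow_le_half (K : ℝ) {δ : ℝ≥0} (hδ : 0 < δ) {α : ℝ} (hα : 1 < α) :
    ∀ᶠ M : ℝ≥0 in atTop, K * ((δ * M : ℝ≥0) : ℝ) ^ (-α) ≤ 1 / 2 := by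
  have h1 : Tendsto (fun M : ℝ≥0 => δ * M) atTop atTop := tendsto_id.const_mul_atTop hδ
  have h := ((tendsto_coe_rpow_neg (by linarith : 0 < α)).comp h1).const_mul K
  rw [mul_zero] at h
  exact h.eventually_le_const (by norm_num)

/-- With `ε` of order `M ^ (-α)`, the left side has order `M ^ (-(α - 1) / 4)`, the square of the
allowed level `M ^ (-(α - 1) / 8)`. -/
lemma eventually_sqrt_mul_rpow_le {K : ℝ} (hK : 0 ≤ K) {δ : ℝ≥0} (hδ : 0 < δ) {α : ℝ}
    (hα : 1 < α) :
    ∀ᶠ M : ℝ≥0 in atTop, √(K * ((δ * M : ℝ≥0) : ℝ) ^ (-α)) * (M : ℝ) ^ ((1 + α) / 4) ≤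
      √(1 - K * ((δ * M : ℝ≥0) : ℝ) ^ (-α)) * (M : ℝ) ^ (-((α - 1) / 8)) := by
  filter_upwards [eventually_mul_rpow_le_half K hδ hα, eventually_gt_atTop 0,
    (tendsto_coe_rpow_atTop (by linarith : 0 < (α - 1) / 4)).eventually_ge_atTop
      (2 * K * (δ : ℝ) ^ (-α))] with M hε hM hge
  have hM' : (0 : ℝ) < M := hM
  set ε := K * ((δ * M : ℝ≥0) : ℝ) ^ (-α) with hεdef
  have hε0 : 0 ≤ ε := mul_nonneg hK (by positivity)
  rw [← Real.sqrt_sq (by positivity : (0 : ℝ) ≤ (M : ℝ) ^ ((1 + α) / 4)),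
    ← Real.sqrt_sq (by positivity : (0 : ℝ) ≤ (M : ℝ) ^ (-((α - 1) / 8))),
    ← Real.sqrt_mul hε0, ← Real.sqrt_mul (by linarith)]
  refine Real.sqrt_le_sqrt ?_
  have e1 : ((M : ℝ) ^ (-((α - 1) / 8))) ^ 2 =
      (M : ℝ) ^ ((α - 1) / 4) * ((M : ℝ) ^ (-α) * ((M : ℝ) ^ ((1 + α) / 4)) ^ 2) := by
    rw [← Real.rpow_mul_natCast hM'.le, ← Real.rpow_mul_natCast hM'.le, ← Real.rpow_add hM',
      ← Real.rpow_add hM']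
    congr 1
    push_cast
    ring
  have e2 : ε = K * (δ : ℝ) ^ (-α) * (M : ℝ) ^ (-α) := by
    rw [hεdef, NNReal.coe_mul, Real.mul_rpow (NNReal.coe_nonneg δ) hM'.le, mul_assoc]
  set y := (M : ℝ) ^ (-α) * ((M : ℝ) ^ ((1 + α) / 4)) ^ 2
  have hy : 0 ≤ y := by positivity
  calc ε * ((M : ℝ) ^ ((1 + α) / 4)) ^ 2 = 1 / 2 * (2 * K * (δ : ℝ) ^ (-α) * y) := by
        rw [e2]
        ring
    _ ≤ 1 / 2 * ((M : ℝ) ^ ((α - 1) / 4) * y) := by gcongr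
    _ = 1 / 2 * ((M : ℝ) ^ (-((α - 1) / 8))) ^ 2 := by rw [e1]
    _ ≤ (1 - ε) * ((M : ℝ) ^ (-((α - 1) / 8))) ^ 2 := by
        gcongr
        linarith

/-- The square of the threshold is `M ^ ((1 + α) / 2)`, which outgrows `M` since `α > 1`; the
resulting factor `2` is absorbed by `a₁ < a₂`. -/
lemma eventually_exp_add_exp_le {α a₁ a₂ : ℝ} (hα : 1 < α) (ha : a₁ < a₂) :
    ∀ᶠ M : ℝ≥0 in atTop, Real.exp (-((M : ℝ) ^ ((1 + α) / 4)) ^ 2 / 4) +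
      Real.exp (-a₂ * M) ≤ Real.exp (-a₁ * M) := by
  filter_upwards [(tendsto_coe_rpow_atTop (by linarith : 0 < (α - 1) / 2)).eventually_ge_atTop
      (4 * a₂), eventually_mul_le_mul_add ha (-Real.log 2), eventually_gt_atTop 0] with M h1 h2 hM
  have hM' : (0 : ℝ) < M := hM
  have e1 : ((M : ℝ) ^ ((1 + α) / 4)) ^ 2 = (M : ℝ) ^ ((α - 1) / 2) * M := by
    rw [← Real.rpow_mul_natCast hM'.le, ← Real.rpow_add_one hM'.ne']
    congr 1
    push_cast
    ring
  have h3 : Real.exp (-((M : ℝ) ^ ((1 + α) / 4)) ^ 2 / 4) ≤ Real.exp (-a₂ * M) := by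
    refine Real.exp_le_exp.2 ?_
    rw [e1]
    nlinarith
  calc _ ≤ Real.exp (-a₂ * M) + Real.exp (-a₂ * M) := by gcongr
    _ = Real.exp (Real.log 2 + -a₂ * M) := by
        rw [Real.exp_add, Real.exp_log two_pos]
        ring
    _ ≤ Real.exp (-a₁ * M) := Real.exp_le_exp.2 (by linarith)

end Scales

/-! ### Uniform bounds along the sequence of processes -/

section Main

variable {Ω : ℕ → Type u} [∀ k, MeasurableSpace (Ω k)] {μ : ∀ k, Measure (Ω k)}
  {Z : ∀ k, ℝ≥0 → Ω k → ℝ}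

lemma exists_polynomial_decay
    (h : limsup (fun p : ℕ × ℝ≥0 => ⨆ s : ℝ≥0,
      ENNReal.log (ENNReal.ofReal (autocorr (Z p.1) (μ p.1) s (s + p.2))) /
        ((Real.log (p.2 : ℝ) : ℝ) : EReal)) (atTop ×ˢ atTop) < (-1 : EReal)) :
    ∃ α : ℝ, 1 < α ∧ ∃ τ₀ : ℝ≥0, ∀ᶠ k in atTop, ∀ s τ, τ₀ ≤ τ →
      autocorr (Z k) (μ k) s (s + τ) ≤ (τ : ℝ) ^ (-α) := by
  obtain ⟨r, hr1, hr2⟩ := EReal.lt_iff_exists_real_btwn.1 h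
  have hr : r < -1 := by
    rw [← EReal.coe_lt_coe_iff]
    simpa using hr2
  have hev := eventually_lt_of_limsup_lt hr1
  rw [prod_atTop_atTop_eq, eventually_atTop] at hev
  obtain ⟨⟨k₀, τ₀⟩, hev⟩ := hev
  -- Lags of at least `2` make `log τ` positive, so that the quotient can be cleared.
  refine ⟨-r, by linarith, max τ₀ 2, eventually_atTop.2 ⟨k₀, fun k hk s τ hτ => ?_⟩⟩
  have h1 := (le_iSup _ s).trans (hev (k, τ) ⟨hk, (le_max_left _ _).trans hτ⟩).le
  have hτ2 : (2 : ℝ) ≤ τ := by exact_mod_cast (le_max_right _ _).trans hτ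
  rw [log_div_le_iff (Real.log_pos (by linarith)),
    ENNReal.ofReal_le_ofReal_iff (Real.exp_pos _).le] at h1
  rwa [neg_neg, Real.rpow_def_of_pos (by linarith), mul_comm]

lemma eventually_lt_logRate {Ωinf : Type u} [MeasurableSpace Ωinf] {μinf : Measure Ωinf}
    [IsProbabilityMeasure μinf] {Zinf : ℝ≥0 → Ωinf → ℝ} {b : EReal}
    (hZ : ∀ k, IsCenteredGaussian (Z k) (μ k)) (h1 : ∀ k t, Var[Z k t; μ k] = 1)
    (hA : ∀ k s t, 0 ≤ autocorr (Z k) (μ k) s t)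
    (hb : Tendsto (fun T : ℝ≥0 => -logRate T (μinf {ω | windowSup Zinf 0 T ω < 0})) atTop (𝓝 b))
    {M₁ : ℝ≥0} (hconv : ∀ M : ℝ≥0, M₁ ≤ M → μinf {ω | windowSup Zinf 0 M ω < 0} ≤
      liminf (fun k : ℕ => ⨅ s : ℝ≥0, μ k {ω | windowSup (Z k) s M ω < 0}) atTop)
    {a : EReal} (ha : a < -b) :
    ∀ᶠ p : ℕ × ℝ≥0 in atTop ×ˢ atTop,
      a < logRate p.2 (μ p.1 {ω | windowSup (Z p.1) 0 p.2 ω < 0}) := by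
  obtain ⟨c, hac, hcb⟩ := EReal.lt_iff_exists_real_btwn.1 ha
  obtain ⟨d, had, hdc⟩ := EReal.lt_iff_exists_real_btwn.1 hac
  have hlim : Tendsto (fun T : ℝ≥0 => logRate T (μinf {ω | windowSup Zinf 0 T ω < 0})) atTop
      (𝓝 (-b)) := ((continuous_neg.tendsto b).comp hb).congr fun T => neg_neg _
  obtain ⟨M, hcM, hM₁, hM0⟩ := ((hlim.eventually_const_lt hcb).and
    ((eventually_ge_atTop M₁).and (eventually_gt_atTop 0))).exists
  have hc : c ≤ 0 := EReal.coe_nonpos.1 (hcM.le.trans (logRate_nonpos hM0 prob_le_one))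
  have hk := eventually_lt_of_lt_liminf (((lt_logRate_iff hM0).1 hcM).trans_le (hconv M hM₁))
  refine (hk.prod_mk ((eventually_mul_le_mul_add (EReal.coe_lt_coe_iff.1 hdc) (c * M)).and
    (eventually_gt_atTop 0))).mono ?_
  rintro ⟨k, T⟩ ⟨hk, hT, hT0⟩
  refine had.trans_le (le_logRate_persistProb (hZ k) (fun s t => ?_) hM0 hc
    (fun s => hk.trans_le (iInf_le _ s)) hT0 hT)
  rw [cov_eq_autocorr_mul (h1 k) one_pos, mul_one]
  exact hA k s t

lemma eventually_logRate_le {Ωinf : Type u} [MeasurableSpace Ωinf] {μinf : Measure Ωinf}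
    {Zinf : ℝ≥0 → Ωinf → ℝ} {b : EReal}
    (hZ : ∀ k, IsCenteredGaussian (Z k) (μ k)) (h1 : ∀ k t, Var[Z k t; μ k] = 1)
    (hdecay : limsup (fun p : ℕ × ℝ≥0 => ⨆ s : ℝ≥0,
      ENNReal.log (ENNReal.ofReal (autocorr (Z p.1) (μ p.1) s (s + p.2))) /
        ((Real.log (p.2 : ℝ) : ℝ) : EReal)) (atTop ×ˢ atTop) < (-1 : EReal))
    (hlevel : ∀ η : ℝ, 0 < η → limsup (fun M : ℝ≥0 => logRate M
      (μinf {ω | windowSup Zinf 0 M ω < (((M : ℝ) ^ (-η) : ℝ) : EReal)})) atTop = -b)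
    {ζ : ℝ} (hζ : 0 < ζ) {M₁ : ℝ≥0}
    (hconv : ∀ z : ℝ, 0 ≤ z → z ≤ ζ → ∀ M : ℝ≥0, M₁ ≤ M →
      limsup (fun k : ℕ => ⨆ s : ℝ≥0, μ k {ω | windowSup (Z k) s M ω < (z : EReal)}) atTop ≤
        μinf {ω | windowSup Zinf 0 M ω ≤ (z : EReal)})
    {a : ℝ} (ha0 : 0 ≤ a) (ha : (a : EReal) < b) :
    ∀ᶠ p : ℕ × ℝ≥0 in atTop ×ˢ atTop,
      logRate p.2 (μ p.1 {ω | windowSup (Z p.1) 0 p.2 ω < 0}) ≤ ((-a : ℝ) : EReal) := by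
  obtain ⟨α, hα, τ₀, hdec⟩ := exists_polynomial_decay hdecay
  obtain ⟨a₂, ha2, ha2b⟩ := EReal.lt_iff_exists_real_btwn.1 ha
  have ha2 : a < a₂ := EReal.coe_lt_coe_iff.1 ha2
  obtain ⟨a₁, ha1, ha12⟩ := exists_between ha2
  -- Windows fill only the fraction `1 / (1 + δ)` of the time; the loss must fit between `a` and
  -- `a₁`. The `a + 1` in the witness covers `a = 0`.
  obtain ⟨δ, hδ, hδa⟩ : ∃ δ : ℝ≥0, 0 < δ ∧ a * (1 + δ) < a₁ := by
    have he : 0 < (a₁ - a) / (2 * (a + 1)) := div_pos (by linarith) (by linarith)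
    refine ⟨Real.toNNReal _, Real.toNNReal_pos.2 he, ?_⟩
    rw [Real.coe_toNNReal _ he.le]
    have : a * ((a₁ - a) / (2 * (a + 1))) ≤ (a₁ - a) / 2 := by
      rw [← mul_div_assoc, div_le_div_iff₀ (by linarith) two_pos]
      nlinarith
    linarith
  set η := (α - 1) / 8 with hη
  have hη0 : 0 < η := by simp only [hη]; linarith
  have hlev : ∀ᶠ M : ℝ≥0 in atTop, logRate M (μinf {ω | windowSup Zinf 0 M ω <
      (((M : ℝ) ^ (-(η / 4)) : ℝ) : EReal)}) < ((-a₂ : ℝ) : EReal) := by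
    refine eventually_lt_of_limsup_lt ?_
    rw [hlevel _ (by linarith), EReal.coe_neg]
    exact EReal.neg_lt_neg_iff.2 ha2b
  obtain ⟨M, hlevM, hM₁, hM1, hMτ, hMε, hMz, hMe, hMζ⟩ := (hlev.and ((eventually_ge_atTop M₁).and
    ((eventually_gt_atTop 1).and (((tendsto_id.const_mul_atTop hδ).eventually_ge_atTop τ₀).and
    ((eventually_mul_rpow_le_half (powerMass α) hδ hα).and
    ((eventually_sqrt_mul_rpow_le (powerMass_pos hα).le hδ hα).and
    ((eventually_exp_add_exp_le hα ha12).and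
    ((tendsto_coe_rpow_neg (by linarith : 0 < η / 2)).eventually_le_const hζ)))))))).exists
  have hM0 : 0 < M := one_pos.trans hM1
  have hM0' : (0 : ℝ) < M := hM0
  have hM1' : (1 : ℝ) < M := hM1
  have hδ' : (0 : ℝ) < δ := hδ
  -- Three levels, because strictness is lost twice: passing from `≤` to `<` for the `k`-th process,
  -- and again for the limit process.
  have hz12 : (M : ℝ) ^ (-η) < (M : ℝ) ^ (-(η / 2)) :=
    Real.rpow_lt_rpow_of_exponent_lt hM1' (by linarith)
  have hz24 : (M : ℝ) ^ (-(η / 2)) < (M : ℝ) ^ (-(η / 4)) :=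
    Real.rpow_lt_rpow_of_exponent_lt hM1' (by linarith)
  have hk := eventually_lt_of_limsup_lt
    (((hconv _ (by positivity) hMζ M hM₁).trans (measure_mono fun ω
      (hω : windowSup Zinf 0 M ω ≤ _) => hω.trans_lt (EReal.coe_lt_coe_iff.2 hz24))).trans_lt
      ((logRate_lt_iff hM0).1 hlevM))
  have hrate : a < a₁ * M / (M + (δ * M : ℝ≥0)) := by
    rw [NNReal.coe_mul, lt_div_iff₀ (by positivity)]
    nlinarith
  refine ((hk.and hdec).prod_mk ((eventually_mul_le_mul_add hrate (-(a₁ * M))).and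
    (eventually_gt_atTop 0))).mono ?_
  rintro ⟨k, T⟩ ⟨⟨hk, hdec⟩, hT, hT0⟩
  refine logRate_persistProb_le (hZ k) (h1 k) hα hM0 hdec (mul_pos hδ hM0) hMτ (by linarith)
    (by positivity) hMz (by linarith) hMe (fun s => ?_) hT0 hT
  refine lt_of_le_of_lt (measure_mono fun ω (hω : windowSup (Z k) s M ω ≤ _) => ?_)
    ((le_iSup _ s).trans_lt hk)
  exact hω.trans_lt (EReal.coe_lt_coe_iff.2 hz12)

end Main

end Persistence

end

theorem mainTheorem2 :
    ∃ b : (ℝ≥0 → ℝ) → EReal,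
      -- existence of the non-negative, possibly infinite, persistence exponent `b A`
      (∀ A ∈ Persistence.StationaryAutocorrPlus, 0 ≤ b A ∧
        ∀ (Ω : Type u) [MeasurableSpace Ω] (μ : Measure Ω) [IsProbabilityMeasure μ]
          (Z : ℝ≥0 → Ω → ℝ), Persistence.IsStationaryGaussian Z μ A →
          Tendsto
            (fun T : ℝ≥0 => -Persistence.logRate T (μ {ω | Persistence.windowSup Z 0 T ω < 0}))
            atTop (𝓝 (b A))) ∧
      -- continuity of the persistence exponent
      (∀ (Ω : ℕ → Type u) [∀ k, MeasurableSpace (Ω k)] (μ : ∀ k, Measure (Ω k))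
          [∀ k, IsProbabilityMeasure (μ k)] (Z : ∀ k, ℝ≥0 → Ω k → ℝ)
          (Ωinf : Type u) [MeasurableSpace Ωinf] (μinf : Measure Ωinf)
          [IsProbabilityMeasure μinf] (Zinf : ℝ≥0 → Ωinf → ℝ) (Ainf : ℝ≥0 → ℝ),
          (∀ k, Persistence.IsCenteredGaussian (Z k) (μ k)) →
          (∀ k t, Var[Z k t; μ k] = 1) →
          (∀ k s t, 0 ≤ Persistence.autocorr (Z k) (μ k) s t) →
          Ainf ∈ Persistence.StationaryAutocorrPlus →
          Persistence.IsStationaryGaussian Zinf μinf Ainf →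
          (∀ t, Var[Zinf t; μinf] = 1) →
          -- uniform polynomial decay of the correlations
          limsup
            (fun p : ℕ × ℝ≥0 => ⨆ s : ℝ≥0,
              ENNReal.log (ENNReal.ofReal (Persistence.autocorr (Z p.1) (μ p.1) s (s + p.2))) /
                ((Real.log (p.2 : ℝ) : ℝ) : EReal))
            (atTop ×ˢ atTop) < (-1 : EReal) →
          -- stability of the limiting persistence probability at small positive levels
          (∀ η : ℝ, 0 < η →
            limsup
              (fun M : ℝ≥0 => Persistence.logRate M
                (μinf {ω | Persistence.windowSup Zinf 0 M ω < (((M : ℝ) ^ (-η) : ℝ) : EReal)}))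
              atTop = -b Ainf) →
          -- convergence of the distribution of suprema over compact windows
          (∃ ζ : ℝ, 0 < ζ ∧ ∃ M₁ : ℝ≥0, ∀ z : ℝ, 0 ≤ z → z ≤ ζ → ∀ M : ℝ≥0, M₁ ≤ M →
            μinf {ω | Persistence.windowSup Zinf 0 M ω < (z : EReal)} ≤
              liminf (fun k : ℕ => ⨅ s : ℝ≥0,
                μ k {ω | Persistence.windowSup (Z k) s M ω < (z : EReal)}) atTop ∧
            limsup (fun k : ℕ => ⨆ s : ℝ≥0,
                μ k {ω | Persistence.windowSup (Z k) s M ω < (z : EReal)}) atTop ≤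
              μinf {ω | Persistence.windowSup Zinf 0 M ω ≤ (z : EReal)}) →
          Tendsto
            (fun p : ℕ × ℝ≥0 => Persistence.logRate p.2
              (μ p.1 {ω | Persistence.windowSup (Z p.1) 0 p.2 ω < 0}))
            (atTop ×ˢ atTop) (𝓝 (-b Ainf))) := by
  choose b hb using fun (A : ℝ≥0 → ℝ) (hA : A ∈ Persistence.StationaryAutocorrPlus) =>
    Persistence.exists_persistence_exponent.{u} hA
  classical
  refine ⟨fun A => if hA : A ∈ Persistence.StationaryAutocorrPlus then b A hA else 0,
    fun A hA => ?_, ?_⟩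
  · simp only [dif_pos hA]
    exact hb A hA
  intro Ω _ μ _ Z Ωinf _ μinf _ Zinf Ainf hZ h1 hA hAinf hZinf _ hdecay hlevel hconv
  simp only [dif_pos hAinf] at hlevel ⊢
  obtain ⟨hb0, hlim⟩ := hb Ainf hAinf
  have hlim := hlim Ωinf μinf Zinf hZinf
  set β := b Ainf hAinf
  obtain ⟨ζ, hζ, M₁, hconv⟩ := hconv
  refine tendsto_order.2 ⟨fun a ha => ?_, fun a ha => ?_⟩
  · exact Persistence.eventually_lt_logRate hZ h1 hA hlim
      (fun M hM => by simpa using (hconv 0 le_rfl hζ.le M hM).1) ha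
  -- For exponent zero, the trivial bound by probability one suffices; otherwise a negative rate `c`
  -- below `a` is available.
  · rcases hb0.eq_or_lt with hβ | hβ
    · have h0 : ∀ᶠ p : ℕ × ℝ≥0 in atTop ×ˢ atTop, 0 < p.2 :=
        tendsto_snd.eventually (eventually_gt_atTop 0)
      filter_upwards [h0] with p hp
      refine (Persistence.logRate_nonpos hp prob_le_one).trans_lt ?_
      simpa [← hβ] using ha
    · obtain ⟨c, hc, hca⟩ := EReal.lt_iff_exists_real_btwn.1
        (lt_min ha (EReal.neg_lt_comm.1 (by simpa using hβ) : -β < 0))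
      have hc0 : c < 0 := EReal.coe_neg'.1 (hca.trans_le (min_le_right _ _))
      have hcβ : ((-c : ℝ) : EReal) < β := by
        rw [EReal.coe_neg]
        exact EReal.neg_lt_comm.1 hc
      filter_upwards [Persistence.eventually_logRate_le hZ h1 hdecay hlevel hζ
        (fun z h0 hz M hM => (hconv z h0 hz M hM).2) (neg_nonneg.2 hc0.le) hcβ] with p hp
      rw [neg_neg] at hp
      exact hp.trans_lt (hca.trans_le (min_le_left _ _))
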